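/- Let $d \ge 1$ and let $\mathbf{x} : [0,1] \to \mathbb{R}^d$ be a $d$-order path, i.e. a Lipschitz path such that - $\mathbf{x}$ is simple, possibly closed: if $0 \le s < t \le 1$ and $\mathbf{x}(s) = \mathbf{x}(t)$, then $s = 0$ and $t = 1$; - every affine hyperplane of $\mathbb{R}^d$ meets the image $\mathbf{x}([0,1])$ in at most $d$ points; - $\mathbf{x}$ is positively oriented: there are $0 \le t_0 < \dots < t_d \le 1$ with $$\det \begin{pmatrix} 1 & 1 & \dots & 1 \\ \mathbf{x}(t_0) & \mathbf{x}(t_1) & \dots & \mathbf{x}(t_d) \end{pmatrix} > 0 .$$ (For a Lipschitz path with $\mathbf{x}(0) \ne \mathbf{x}(1)$ these conditions hold together if and only if this determinant is positive for all $0 \le t_0 < \dots < t_d \le 1$.) Let $$\alpha^{(d)}(\mathbf{x}) = \frac{1}{d!} \int_{\Delta^d} \det\bigl(\mathbf{x}'(t_1), \dots, \mathbf{x}'(t_d)\bigr) \, \mathrm{d}t_1 \cdots \mathrm{d}t_d, \qquad \Delta^d = \{0 \le t_1 < \dots < t_d \le 1\},$$ be the level $d$ alternating signature of $\mathbf{x}$.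 Then the $d$-dimensional volume of the convex hull of the image of $\mathbf{x}$ is $$\operatorname{vol}(\operatorname{conv}(\mathbf{x})) = \alpha^{(d)}(\mathbf{x}).$$ -/

import Mathlib

open MeasureTheory

/-- The `(d+1) × (d+1)` matrix whose first row consists of ones and whose `j`-th column continues
with the coordinates of the point `x (t j)`. -/
def borderedMatrix {d : ℕ} (x : ℝ → EuclideanSpace ℝ (Fin d)) (t : Fin (d + 1) → ℝ) :
    Matrix (Fin (d + 1)) (Fin (d + 1)) ℝ :=
  Matrix.of fun i j => (Fin.cons 1 (fun k : Fin d => x (t j) k) : Fin (d + 1) → ℝ) i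

/-- A `d`-order path `x : [0,1] → ℝ^d`, given as the restriction of a function on `ℝ` to `[0,1]`. -/
structure IsDOrderPath {d : ℕ} (x : ℝ → EuclideanSpace ℝ (Fin d)) : Prop where
  /-- The path is Lipschitz on `[0,1]`. -/
  lipschitz : ∃ K : NNReal, LipschitzOnWith K x (Set.Icc 0 1)
  /-- The path is simple, possibly closed: no point is visited twice, except that the two end
  points may coincide. -/
  simple : ∀ s ∈ Set.Icc (0 : ℝ) 1, ∀ t ∈ Set.Icc (0 : ℝ) 1, s < t → x s = x t → s = 0 ∧ t = 1
  /-- Every affine hyperplane `{y | ⟪v, y⟫ = c}`, `v ≠ 0`, meets the image in at most `d` points. -/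
  hyperplane : ∀ (v : EuclideanSpace ℝ (Fin d)) (c : ℝ), v ≠ 0 →
    ((x '' Set.Icc 0 1) ∩ {y | inner ℝ v y = c}).encard ≤ d
  /-- The path is traversed in the positive direction: reversing the path or reflecting the space
  may change the common sign of the bordered determinants, so the hyperplane condition alone
  leaves this sign open. -/
  positive : ∃ t : Fin (d + 1) → ℝ, StrictMono t ∧ (∀ i, t i ∈ Set.Icc 0 1) ∧
    0 < (borderedMatrix x t).det

/-- The simplex `{0 ≤ t_1 < ⋯ < t_k ≤ 1}`. -/
def orderSimplex (k : ℕ) : Set (Fin k → ℝ) :=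
  {t | StrictMono t ∧ ∀ i, t i ∈ Set.Icc 0 1}

/-- The alternating signature of `x` with respect to an order-preserving injection `P`,
`(1 / k!) ∫_{Δ^k} det (x'_{P i} (t_j))_{i,j} dt`. -/
noncomputable def altSignatureCoord {d k : ℕ} (x : ℝ → EuclideanSpace ℝ (Fin d))
    (P : Fin k ↪o Fin d) : ℝ :=
  (1 / (Nat.factorial k : ℝ)) *
    ∫ t in orderSimplex k, (Matrix.of fun i j : Fin k => deriv x (t j) (P i)).det

/-- The level `d` alternating signature of a path in `ℝ^d`. The space of alternating tensors of
top degree is one-dimensional, so this is the single coordinate indexed by the identity. -/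
noncomputable def topAltSignature {d : ℕ} (x : ℝ → EuclideanSpace ℝ (Fin d)) : ℝ :=
  altSignatureCoord x (RelEmbedding.refl (· ≤ · : Fin d → Fin d → Prop))

/-! Write `d = 2k + m` with `m ∈ {0, 1}`. The bordered determinants do not vanish on the connected
open simplex of parameters, so all of them are positive there; on the closed simplex they are
nonnegative, and zero is possible only if a closed path is sampled at both ends (`det_pos`,
`det_nonneg`).

Consequently almost every point of the convex hull is, in exactly one way, a convex combination of
`x 0`, of `k` points `x (s i)` with `0 < s_1 < ⋯ < s_k < 1`, and, for `m = 1`, of `x 1`. The `k + m`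
free weights and `k` nodes give `d` parameters. Uniqueness is affine independence of up to `d + 1`
points of the path (`injOn_nodePoint`). For existence, follow the ray from `x 0` through the point
to the boundary of the hull; a supporting hyperplane there touches the path in few points
(`card_zeros_le`, `interior_convexHull_subset`).

Change of variables expresses the volume as an integral of the Jacobian, which is `λ_1 ⋯ λ_k` times
the determinant with columns `x (s i) - x 0`, `x 1 - x 0` and `x' (s i)`; this determinant is a
limit of nonnegative multiples of bordered determinants (`det_nodeMatrix_nonneg`). Integrating out
the weights is a Dirichlet integral with value `1 / d!` (`integral_nodeDomain`). Column operations
turn the differences into increments between consecutive nodes, that is, integrals of `x'`. By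
multilinearity and Fubini the remaining integral over the nodes is that of `det (x' (t_1), …, x'
(t_d))` over `Δ^d`, with the nodes as the variables `t_2, t_4, …`
(`integral_interleavedSimplex_det`). -/

/-! ### Determinant identities. -/

/-- Column operations: adding to each column a combination of earlier columns keeps the
determinant. -/
theorem Matrix.det_eq_of_col_sub_mem_span {n : Type*} [Fintype n] [LinearOrder n]
    (A B : Matrix n n ℝ)
    (h : ∀ j, (fun i => B i j - A i j) ∈
      Submodule.span ℝ ((fun l i => A i l) '' {l | l < j})) : B.det = A.det := by
  classical
  have h' : ∀ j, ∃ c : n → ℝ, (∀ l, ¬ l < j → c l = 0) ∧ ∀ i, B i j - A i j = ∑ l, c l * A i l := by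
    intro j
    obtain ⟨f, hf, hfe⟩ := (Finsupp.mem_span_image_iff_linearCombination ℝ).1 (h j)
    refine ⟨f, fun l hl => ?_, fun i => ?_⟩
    · by_contra hne
      exact hl ((Finsupp.mem_supported ℝ f).1 hf (Finsupp.mem_support_iff.2 hne))
    · have := congrFun hfe i
      rw [Finsupp.linearCombination_apply, Finsupp.sum_fintype _ _ (by simp)] at this
      simpa [Finset.sum_apply] using this.symm
  choose c hc hB using h'
  -- The operations amount to right multiplication by a unitriangular matrix.
  let U : Matrix n n ℝ := 1 + Matrix.of fun l j => c j l
  have hU : U.det = 1 := by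
    rw [Matrix.det_of_isUpperTriangular]
    · refine Finset.prod_eq_one fun j _ => ?_
      simp [U, hc j j (lt_irrefl _)]
    · intro i j hij
      have hij : j < i := hij
      simp [U, Matrix.one_apply_ne hij.ne', hc j i hij.not_gt]
  have hBA : B = A * U := by
    rw [Matrix.mul_add, Matrix.mul_one]
    ext i j
    simp only [Matrix.add_apply, Matrix.mul_apply, Matrix.of_apply]
    have := hB j i
    simp_rw [mul_comm (A i _)]
    linarith
  rw [hBA, Matrix.det_mul, hU, mul_one]

/-- Serves matrices indexed by weights and nodes, whose columns are swept in the order transported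
along `e`. -/
theorem Matrix.det_eq_of_col_sub_mem_span_of_equiv {n o : Type*} [Fintype n] [DecidableEq n]
    [Fintype o] [LinearOrder o] (e : n ≃ o) (A B : Matrix n n ℝ)
    (h : ∀ j, (fun i => B i j - A i j) ∈
      Submodule.span ℝ ((fun l i => A i l) '' {l | e l < e j})) : B.det = A.det := by
  rw [← Matrix.det_submatrix_equiv_self e.symm B, ← Matrix.det_submatrix_equiv_self e.symm A]
  refine Matrix.det_eq_of_col_sub_mem_span _ _ fun j => ?_
  have h1 := Submodule.mem_map_of_mem (f := LinearMap.funLeft ℝ ℝ e.symm) (h (e.symm j))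
  rw [Submodule.map_span, ← Set.image_comp] at h1
  refine Submodule.span_mono ?_ h1
  rintro _ ⟨l, hl, rfl⟩
  refine ⟨e l, by simpa using hl, ?_⟩
  ext i
  simp [LinearMap.funLeft]

/-- The canonical linear relation between `n + 1` vectors in `ℝ ^ n`. -/
theorem sum_neg_one_pow_mul_det_succAbove {n : ℕ} (M : Matrix (Fin n) (Fin (n + 1)) ℝ)
    (v : Fin n → ℝ) :
    ∑ j : Fin (n + 1), (-1 : ℝ) ^ (j : ℕ) * (∑ r, v r * M r j) *
      (M.submatrix id j.succAbove).det = 0 := by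
  have key : ∀ r, ∑ j : Fin (n + 1), (-1 : ℝ) ^ (j : ℕ) * M r j *
      (M.submatrix id j.succAbove).det = 0 := by
    intro r
    -- Row `r` is repeated on top, so the determinant is zero; its expansion along the top row is
    -- the required sum.
    let N : Matrix (Fin (n + 1)) (Fin (n + 1)) ℝ := 
      Matrix.of (Fin.cons (M r) (fun i => M i) : Fin (n + 1) → Fin (n + 1) → ℝ)
    have hN : N.det = 0 := by
      refine Matrix.det_zero_of_row_eq (i := 0) (j := r.succ) (Fin.succ_ne_zero r).symm ?_
      ext j
      simp [N]
    rw [Matrix.det_succ_row_zero] at hN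
    exact hN
  simp_rw [Finset.mul_sum, Finset.sum_mul]
  rw [Finset.sum_comm]
  refine Finset.sum_eq_zero fun r _ => ?_
  rw [← mul_zero (v r), ← key r, Finset.mul_sum]
  exact Finset.sum_congr rfl fun j _ => by ring

/-- The bordered determinant is the determinant of the differences to the first point. -/
theorem det_borderedMatrix_eq {d : ℕ} (x : ℝ → EuclideanSpace ℝ (Fin d)) (t : Fin (d + 1) → ℝ) :
    (borderedMatrix x t).det =
      (Matrix.of fun i j : Fin d => x (t j.succ) i - x (t 0) i).det := by
  let B : Matrix (Fin (d + 1)) (Fin (d + 1)) ℝ := Matrix.of fun i j =>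
    if j = 0 then borderedMatrix x t i 0 else borderedMatrix x t i j - borderedMatrix x t i 0
  have hB : B.det = (borderedMatrix x t).det := by
    refine Matrix.det_eq_of_col_sub_mem_span _ _ fun j => ?_
    by_cases hj : j = 0
    · convert Submodule.zero_mem _ using 1
      ext i
      simp [B, hj]
    · have : (fun i => B i j - borderedMatrix x t i j) =
          (-1 : ℝ) • (fun i => borderedMatrix x t i 0) := by
        ext i
        simp [B, hj]
      rw [this]
      exact Submodule.smul_mem _ _ (Submodule.subset_span ⟨0, Fin.pos_of_ne_zero hj, rfl⟩)
  rw [← hB, Matrix.det_succ_row_zero, Fin.sum_univ_succ]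
  rw [Finset.sum_eq_zero]
  · simp only [B, borderedMatrix, Matrix.of_apply]
    simp
    congr 1
  · intro j _
    simp [B, borderedMatrix]

/-! ### Positivity of the bordered determinants. -/

namespace IsDOrderPath

variable {d : ℕ} {x : ℝ → EuclideanSpace ℝ (Fin d)}

theorem continuousOn (hx : IsDOrderPath x) : ContinuousOn x (Set.Icc 0 1) :=
  hx.lipschitz.choose_spec.continuousOn

/-- A vanishing determinant gives a relation between the rows, hence a hyperplane through `d + 1`
distinct points of the path. -/
theorem det_borderedMatrix_ne_zero (hx : IsDOrderPath x) {t : Fin (d + 1) → ℝ}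
    (hinj : Function.Injective (x ∘ t)) (hmem : ∀ i, t i ∈ Set.Icc (0 : ℝ) 1) :
    (borderedMatrix x t).det ≠ 0 := by
  intro h0
  obtain ⟨v, hv, hvM⟩ := Matrix.exists_vecMul_eq_zero_iff.2 h0
  have hv' : ∀ j, v 0 + ∑ k : Fin d, v k.succ * x (t j) k = 0 := by
    intro j
    have := congrFun hvM j
    simpa [Matrix.vecMul, dotProduct, borderedMatrix, Fin.sum_univ_succ] using this
  let w : EuclideanSpace ℝ (Fin d) := WithLp.toLp 2 fun k => v k.succ
  have hw : w ≠ 0 := by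
    intro hw
    have hk : ∀ k : Fin d, v k.succ = 0 := fun k => congrFun (congrArg WithLp.ofLp hw) k
    apply hv
    ext i
    refine Fin.cases ?_ (fun k => hk k) i
    simpa [hk] using hv' 0
  have hsub : Set.range (x ∘ t) ⊆ (x '' Set.Icc 0 1) ∩ {y | inner ℝ w y = -v 0} := by
    rintro _ ⟨j, rfl⟩
    refine ⟨⟨t j, hmem j, rfl⟩, ?_⟩
    have := hv' j
    simp only [Set.mem_ofPred_eq, PiLp.inner_apply, Function.comp, w]
    simp only [RCLike.inner_apply, conj_trivial]
    simp_rw [mul_comm (x (t j) _)]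
    linarith
  have h1 := (Set.encard_le_encard hsub).trans (hx.hyperplane w _ hw)
  rw [← Set.image_univ, hinj.encard_image, Set.encard_univ] at h1
  simp only [ENat.card_eq_coe_fintype_card, Fintype.card_fin] at h1
  have : d + 1 ≤ d := by exact_mod_cast h1
  omega

theorem injective_comp (hx : IsDOrderPath x) {t : Fin (d + 1) → ℝ} (ht : StrictMono t)
    (hmem : ∀ i, t i ∈ Set.Icc (0 : ℝ) 1)
    (hends : x 0 ≠ x 1 ∨ 0 < t 0 ∨ t (Fin.last d) < 1) : Function.Injective (x ∘ t) := by
  have key : ∀ i j, i < j → x (t i) ≠ x (t j) := by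
    intro i j hij h
    obtain ⟨h0, h1⟩ := hx.simple _ (hmem i) _ (hmem j) (ht hij) h
    rcases hends with h' | h' | h'
    · exact h' (h0 ▸ h1 ▸ h)
    · have := ht.monotone (Fin.zero_le i)
      linarith
    · have := ht.monotone (Fin.le_last j)
      linarith
  intro i j hij
  rcases lt_trichotomy i j with h | h | h
  · exact (key i j h hij).elim
  · exact h
  · exact (key j i h hij.symm).elim

theorem continuousOn_det (hx : IsDOrderPath x) :
    ContinuousOn (fun t : Fin (d + 1) → ℝ => (borderedMatrix x t).det)
      (Set.univ.pi fun _ => Set.Icc 0 1) := by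
  have hcoord : ∀ (j : Fin (d + 1)) (k : Fin d),
      ContinuousOn (fun t : Fin (d + 1) → ℝ => x (t j) k) (Set.univ.pi fun _ => Set.Icc 0 1) := by
    intro j k
    have h1 : ContinuousOn (fun t : Fin (d + 1) → ℝ => x (t j))
        (Set.univ.pi fun _ => Set.Icc 0 1) :=
      hx.continuousOn.comp (continuous_apply j).continuousOn fun t ht => ht j trivial
    have h2 : Continuous fun v : EuclideanSpace ℝ (Fin d) => v k := by fun_prop
    exact h2.comp_continuousOn h1
  simp_rw [Matrix.det_apply]
  refine continuousOn_finsetSum _ fun σ _ => ContinuousOn.const_smul ?_ _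
  refine continuousOn_finsetProd _ fun j _ => ?_
  simp only [borderedMatrix, Matrix.of_apply]
  generalize σ j = i
  refine Fin.cases ?_ (fun k => ?_) i
  · simpa using continuousOn_const
  · simpa using hcoord j k

/-- Moving towards the point with coordinates `(i + 1) / (d + 2)` pushes a chain that touches the
ends `0`, `1` into the open simplex. -/
theorem smul_add_smul_center_mem {t : Fin (d + 1) → ℝ} (ht : StrictMono t)
    (hmem : ∀ i, t i ∈ Set.Icc (0 : ℝ) 1) {ε : ℝ} (h0 : 0 < ε) (h1 : ε ≤ 1) :
    StrictMono (fun i => (1 - ε) * t i + ε * (((i : ℕ) + 1 : ℝ) / (d + 2))) ∧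
      ∀ i, (1 - ε) * t i + ε * (((i : ℕ) + 1 : ℝ) / (d + 2)) ∈ Set.Ioo (0 : ℝ) 1 := by
  have hd : (0 : ℝ) < d + 2 := by positivity
  constructor
  · intro i j hij
    have h2 : ((i : ℕ) : ℝ) < (j : ℕ) := by exact_mod_cast hij
    have h3 : (((i : ℕ) + 1 : ℝ) / (d + 2)) < (((j : ℕ) + 1 : ℝ) / (d + 2)) := by gcongr
    have h4 := mul_le_mul_of_nonneg_left (ht hij).le (sub_nonneg.2 h1)
    have h5 := mul_lt_mul_of_pos_left h3 h0
    simp only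
    linarith
  · intro i
    have hi : ((i : ℕ) : ℝ) + 1 < d + 2 := by
      have := i.2
      have : (i : ℕ) + 1 < d + 2 := by omega
      exact_mod_cast this
    have h2 : 0 < ((i : ℕ) + 1 : ℝ) / (d + 2) := by positivity
    have h3 : ((i : ℕ) + 1 : ℝ) / (d + 2) < 1 := by rwa [div_lt_one hd]
    have h4 := mul_nonneg (sub_nonneg.2 h1) (hmem i).1
    have h5 := mul_le_mul_of_nonneg_left (hmem i).2 (sub_nonneg.2 h1)
    have h6 := mul_lt_mul_of_pos_left h3 h0
    have h7 := mul_pos h0 h2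
    constructor <;> linarith

theorem tendsto_det_center (hx : IsDOrderPath x) {t : Fin (d + 1) → ℝ} (ht : StrictMono t)
    (hmem : ∀ i, t i ∈ Set.Icc (0 : ℝ) 1) :
    Filter.Tendsto (fun ε : ℝ => (borderedMatrix x
        (fun i => (1 - ε) * t i + ε * (((i : ℕ) + 1 : ℝ) / (d + 2)))).det)
      (nhdsWithin 0 (Set.Ioc 0 1)) (nhds (borderedMatrix x t).det) := by
  have h1 : ContinuousWithinAt (fun t : Fin (d + 1) → ℝ => (borderedMatrix x t).det)
      (Set.univ.pi fun _ => Set.Icc 0 1) t := hx.continuousOn_det t fun i _ => hmem i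
  refine h1.tendsto.comp (tendsto_nhdsWithin_iff.2 ⟨?_, ?_⟩)
  · have : Continuous fun ε : ℝ =>
        (fun i : Fin (d + 1) => (1 - ε) * t i + ε * (((i : ℕ) + 1 : ℝ) / (d + 2))) := by
      fun_prop
    simpa using (this.tendsto 0).mono_left nhdsWithin_le_nhds
  · filter_upwards [self_mem_nhdsWithin] with ε hε i _
    exact Set.Ioo_subset_Icc_self ((smul_add_smul_center_mem ht hmem hε.1 hε.2).2 i)

theorem convex_openSimplex (n : ℕ) :
    Convex ℝ {t : Fin n → ℝ | StrictMono t ∧ ∀ i, t i ∈ Set.Ioo (0 : ℝ) 1} := by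
  rintro s ⟨hs, hs'⟩ t ⟨ht, ht'⟩ a b ha hb hab
  refine ⟨fun i j hij => ?_, fun i => convex_Ioo (0 : ℝ) 1 (hs' i) (ht' i) ha hb hab⟩
  have h1 := hs hij
  have h2 := ht hij
  simp only [Pi.add_apply, Pi.smul_apply, smul_eq_mul]
  have h3 := mul_le_mul_of_nonneg_left h1.le ha
  have h4 := mul_le_mul_of_nonneg_left h2.le hb
  rcases ha.eq_or_lt with h | h
  · have hb1 : b = 1 := by linarith
    subst h hb1
    linarith
  · have := mul_lt_mul_of_pos_left h1 h
    linarith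

/-- The determinant is continuous and nowhere zero on the convex open simplex, so its sign is
constant there. The witness of `positive` may use the end points, so it is first moved inwards. -/
theorem det_pos_of_mem_Ioo (hx : IsDOrderPath x) {t : Fin (d + 1) → ℝ} (ht : StrictMono t)
    (hmem : ∀ i, t i ∈ Set.Ioo (0 : ℝ) 1) : 0 < (borderedMatrix x t).det := by
  have : (nhdsWithin (0 : ℝ) (Set.Ioc 0 1)).NeBot := by
    rw [← mem_closure_iff_nhdsWithin_neBot, closure_Ioc zero_ne_one]
    simp
  obtain ⟨t₀, ht₀, hmem₀, hpos⟩ := hx.positive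
  obtain ⟨ε, hεpos, hε⟩ := (((hx.tendsto_det_center ht₀ hmem₀).eventually_const_lt hpos).and
    self_mem_nhdsWithin).exists
  by_contra hneg
  obtain ⟨s, hs, hs0⟩ := (convex_openSimplex (d + 1)).isPreconnected.intermediate_value
    (a := t) (b := fun i => (1 - ε) * t₀ i + ε * (((i : ℕ) + 1 : ℝ) / (d + 2)))
    ⟨ht, hmem⟩ (smul_add_smul_center_mem ht₀ hmem₀ hε.1 hε.2)
    (hx.continuousOn_det.mono fun s hs i _ => Set.Ioo_subset_Icc_self (hs.2 i))
    ⟨not_lt.1 hneg, hεpos.le⟩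
  exact hx.det_borderedMatrix_ne_zero (hx.injective_comp hs.1
    (fun i => Set.Ioo_subset_Icc_self (hs.2 i)) (Or.inr (Or.inl (hs.2 0).1)))
    (fun i => Set.Ioo_subset_Icc_self (hs.2 i)) hs0

theorem det_nonneg (hx : IsDOrderPath x) {t : Fin (d + 1) → ℝ} (ht : StrictMono t)
    (hmem : ∀ i, t i ∈ Set.Icc (0 : ℝ) 1) : 0 ≤ (borderedMatrix x t).det := by
  have : (nhdsWithin (0 : ℝ) (Set.Ioc 0 1)).NeBot := by
    rw [← mem_closure_iff_nhdsWithin_neBot, closure_Ioc zero_ne_one]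
    simp
  refine ge_of_tendsto (hx.tendsto_det_center ht hmem) ?_
  filter_upwards [self_mem_nhdsWithin] with ε hε
  obtain ⟨h1, h2⟩ := smul_add_smul_center_mem ht hmem hε.1 hε.2
  exact (hx.det_pos_of_mem_Ioo h1 h2).le

theorem det_pos (hx : IsDOrderPath x) {t : Fin (d + 1) → ℝ} (ht : StrictMono t)
    (hmem : ∀ i, t i ∈ Set.Icc (0 : ℝ) 1)
    (hends : x 0 ≠ x 1 ∨ 0 < t 0 ∨ t (Fin.last d) < 1) : 0 < (borderedMatrix x t).det :=
  (hx.det_nonneg ht hmem).lt_of_ne'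
    (hx.det_borderedMatrix_ne_zero (hx.injective_comp ht hmem hends) hmem)

/-- In odd dimension, a path of this kind is never closed. -/
theorem apply_zero_ne_apply_one (hx : IsDOrderPath x) (hd : Odd d) : x 0 ≠ x 1 := by
  intro h01
  have hd2 : (0 : ℝ) < d + 1 := by positivity
  have key : ∀ i : Fin (d + 1), ((i : ℕ) : ℝ) / (d + 1) ∈ Set.Ico (0 : ℝ) 1 := fun i =>
    ⟨by positivity, by rw [div_lt_one hd2]; exact_mod_cast i.2⟩
  have h1 := hx.det_pos (t := fun i : Fin (d + 1) => ((i : ℕ) : ℝ) / (d + 1))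
    (fun i j hij => by
      have : ((i : ℕ) : ℝ) < (j : ℕ) := by exact_mod_cast hij
      simp only
      gcongr)
    (fun i => Set.Ico_subset_Icc_self (key i)) (Or.inr (Or.inr (key _).2))
  have h2 := hx.det_pos (t := fun i : Fin (d + 1) => (((i : ℕ) : ℝ) + 1) / (d + 1))
    (fun i j hij => by
      have : ((i : ℕ) : ℝ) < (j : ℕ) := by exact_mod_cast hij
      simp only
      gcongr)
    (fun i => ⟨by positivity, by
      rw [div_le_one hd2]
      have : ((i : ℕ) + 1) ≤ d + 1 := i.2
      exact_mod_cast this⟩)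
    (Or.inr (Or.inl (by positivity)))
  -- The two chains differ only in having `0` or `1`. If the path were closed, one matrix would be a
  -- cyclic column shift of the other, of sign `(-1)^d = -1`, although both determinants are
  -- positive.
  have h3 : borderedMatrix x (fun i : Fin (d + 1) => (((i : ℕ) : ℝ) + 1) / (d + 1)) =
      (borderedMatrix x (fun i : Fin (d + 1) => ((i : ℕ) : ℝ) / (d + 1))).submatrix id
        (finRotate (d + 1)) := by
    ext i j
    simp only [borderedMatrix, Matrix.of_apply, Matrix.submatrix_apply, id]
    have : x ((((j : ℕ) : ℝ) + 1) / (d + 1)) =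
        x ((((finRotate (d + 1) j : Fin (d + 1)) : ℕ) : ℝ) / (d + 1)) := by
      by_cases hj : j = Fin.last d
      · subst hj
        simp [div_self hd2.ne', h01]
      · rw [coe_finRotate_of_ne_last hj]
        push_cast
        rfl
    rw [this]
  rw [h3, Matrix.det_permute', sign_finRotate, Nat.add_sub_cancel, hd.neg_one_pow] at h2
  simp at h2
  linarith

end IsDOrderPath

/-! ### Representations by weights and nodes, and their uniqueness. -/

theorem Set.Infinite.exists_finset_superset_card_eq {α : Type*} {A : Set α} (hA : A.Infinite)
    {T : Finset α} (hT : (T : Set α) ⊆ A) {n : ℕ} (hn : T.card ≤ n) :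
    ∃ T' : Finset α, T ⊆ T' ∧ (T' : Set α) ⊆ A ∧ T'.card = n := by
  classical
  obtain ⟨S, hS, hcard⟩ := (hA.sdiff T.finite_toSet).exists_subset_card_eq (n - T.card)
  refine ⟨T ∪ S, Finset.subset_union_left, ?_, ?_⟩
  · rw [Finset.coe_union]
    exact Set.union_subset hT fun a ha => (hS ha).1
  · rw [Finset.card_union_of_disjoint, hcard]
    · omega
    · exact Finset.disjoint_left.2 fun a ha ha' => (hS ha').2 ha

/-- The nodes carrying weight in the representation with interior nodes `s`: the interior nodes
and, for `m = 1`, the end point `1`. -/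
def upperNode {k : ℕ} (m : ℕ) (s : Fin k → ℝ) : Fin k ⊕ Fin m → ℝ :=
  Sum.elim s fun _ => 1

/-- The point with weights `w (inl c)` at the nodes given by `w ∘ inr`, and the remaining weight
at the initial point of the path. -/
def nodePoint {k m : ℕ} {E : Type*} [AddCommGroup E] [Module ℝ E] (z : ℝ → E)
    (w : (Fin k ⊕ Fin m) ⊕ Fin k → ℝ) : E :=
  z 0 + ∑ c, w (Sum.inl c) • (z (upperNode m (fun i => w (Sum.inr i)) c) - z 0)

/-- The parameters with positive weights and strictly increasing nodes in `(0, 1)`. -/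
def nodeDomain (k m : ℕ) : Set ((Fin k ⊕ Fin m) ⊕ Fin k → ℝ) :=
  {w | ((∀ c, 0 < w (Sum.inl c)) ∧ ∑ c, w (Sum.inl c) < 1) ∧
    StrictMono (fun i => w (Sum.inr i)) ∧ ∀ i, w (Sum.inr i) ∈ Set.Ioo (0 : ℝ) 1}

/-- The parameters with nonnegative weights and strictly increasing nodes in `[0, 1]`. -/
def closedNodeDomain (k m : ℕ) : Set ((Fin k ⊕ Fin m) ⊕ Fin k → ℝ) :=
  {w | ((∀ c, 0 ≤ w (Sum.inl c)) ∧ ∑ c, w (Sum.inl c) ≤ 1) ∧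
    StrictMono (fun i => w (Sum.inr i)) ∧ ∀ i, w (Sum.inr i) ∈ Set.Icc (0 : ℝ) 1}

/-- The mass that the representation with parameters `w` puts at `τ`. -/
noncomputable def nodeMass {k m : ℕ} (w : (Fin k ⊕ Fin m) ⊕ Fin k → ℝ) (τ : ℝ) : ℝ :=
  (∑ c, if upperNode m (fun i => w (Sum.inr i)) c = τ then w (Sum.inl c) else 0) +
    if 0 = τ then 1 - ∑ c, w (Sum.inl c) else 0

/-- Puts two representations on a common finite set of parameters, where their masses can be
subtracted. For constant `z = 1` it says that the total mass is `1`. -/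
theorem sum_nodeMass_smul {k m : ℕ} {E : Type*} [AddCommGroup E] [Module ℝ E]
    (w : (Fin k ⊕ Fin m) ⊕ Fin k → ℝ) (z : ℝ → E) (T : Finset ℝ) (h0 : 0 ∈ T)
    (hT : ∀ c, upperNode m (fun i => w (Sum.inr i)) c ∈ T) :
    ∑ τ ∈ T, nodeMass w τ • z τ = nodePoint z w := by
  simp only [nodeMass, nodePoint, add_smul, Finset.sum_smul, ite_smul, zero_smul,
    Finset.sum_add_distrib, smul_sub, Finset.sum_sub_distrib]
  rw [Finset.sum_comm]
  simp only [Finset.sum_ite_eq, h0, hT, if_true, sub_smul, one_smul, Finset.sum_smul]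
  abel

theorem nodeMass_node {k m : ℕ} {w : (Fin k ⊕ Fin m) ⊕ Fin k → ℝ} (hw : w ∈ nodeDomain k m)
    (i : Fin k) : nodeMass w (w (Sum.inr i)) = w (Sum.inl (Sum.inl i)) := by
  obtain ⟨-, hs, hmem⟩ := hw
  have h1 : ∀ l, w (Sum.inr l) = w (Sum.inr i) ↔ l = i := fun l => hs.injective.eq_iff
  have h2 : ¬ (1 : ℝ) = w (Sum.inr i) := (hmem i).2.ne'
  have h3 : ¬ (0 : ℝ) = w (Sum.inr i) := (hmem i).1.ne
  simp [nodeMass, upperNode, h1, h2, h3]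

theorem nodeMass_one {k m : ℕ} {w : (Fin k ⊕ Fin m) ⊕ Fin k → ℝ} (hw : w ∈ nodeDomain k m) :
    nodeMass w 1 = ∑ j, w (Sum.inl (Sum.inr j)) := by
  obtain ⟨-, hs, hmem⟩ := hw
  have h2 : ∀ i, ¬ w (Sum.inr i) = 1 := fun i => (hmem i).2.ne
  simp [nodeMass, upperNode, h2]

theorem exists_eq_of_nodeMass_ne_zero {k m : ℕ} {w : (Fin k ⊕ Fin m) ⊕ Fin k → ℝ} {τ : ℝ}
    (hτ : τ ∈ Set.Ioo (0 : ℝ) 1) (h : nodeMass w τ ≠ 0) : ∃ i, w (Sum.inr i) = τ := by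
  by_contra! hne
  exact h (by simp [nodeMass, upperNode, hne, hτ.1.ne, hτ.2.ne'])

namespace IsDOrderPath

variable {d : ℕ} {x : ℝ → EuclideanSpace ℝ (Fin d)}

/-- The points `(1, x τ)` for at most `d + 1` parameters are linearly independent. -/
theorem eq_zero_of_sum_eq_zero (hx : IsDOrderPath x) {T : Finset ℝ}
    (hT : ∀ τ ∈ T, τ ∈ Set.Icc (0 : ℝ) 1) (hcard : T.card ≤ d + 1)
    (hends : x 0 ≠ x 1 ∨ ∀ τ ∈ T, τ < 1) (f : ℝ → ℝ) (h0 : ∑ τ ∈ T, f τ = 0)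
    (h1 : ∑ τ ∈ T, f τ • x τ = 0) : ∀ τ ∈ T, f τ = 0 := by
  classical
  -- The padding comes from `[0, 1)`, so the parameter `1` is never added and the condition on the
  -- ends survives.
  obtain ⟨T', hTT', hT'card, hT', hends'⟩ : ∃ T' : Finset ℝ, T ⊆ T' ∧ T'.card = d + 1 ∧
      (∀ τ ∈ T', τ ∈ Set.Icc (0 : ℝ) 1) ∧ (x 0 ≠ x 1 ∨ ∀ τ ∈ T', τ < 1) := by
    have hinf : ((T : Set ℝ) ∪ Set.Ico 0 1).Infinite :=
      (Set.Ico_infinite zero_lt_one).mono Set.subset_union_right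
    obtain ⟨S, hTS, hS, hScard⟩ := hinf.exists_finset_superset_card_eq (T := T)
      Set.subset_union_left hcard
    refine ⟨S, hTS, hScard, fun τ hτ => ?_, hends.imp_right fun h τ hτ => ?_⟩
    · rcases hS hτ with h | h
      · exact hT τ h
      · exact Set.Ico_subset_Icc_self h
    · rcases hS hτ with h' | h'
      · exact h τ h'
      · exact h'.2
  let t := T'.orderEmbOfFin hT'card
  have htm : ∀ j, t j ∈ T' := fun j => T'.orderEmbOfFin_mem hT'card j
  have hdet := hx.det_pos (t := t) t.strictMono (fun j => hT' _ (htm j))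
    (hends'.imp_right fun h => Or.inr (h _ (htm _)))
  have hsum : ∀ g : ℝ → ℝ, ∑ j, (if t j ∈ T then f (t j) else 0) * g (t j) =
      ∑ τ ∈ T, f τ * g τ := by
    intro g
    have h2 := Finset.sum_map Finset.univ t.toEmbedding
      (fun τ => (if τ ∈ T then f τ else 0) * g τ)
    rw [Finset.map_orderEmbOfFin_univ T' hT'card] at h2
    refine h2.symm.trans ?_
    simp only [ite_mul, zero_mul, ← Finset.sum_filter]
    rw [Finset.filter_mem_eq_inter, Finset.inter_eq_right.2 hTT']
  have hzero := Matrix.eq_zero_of_mulVec_eq_zero hdet.ne'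
    (v := fun j => if t j ∈ T then f (t j) else 0) (by
      ext i
      simp only [Matrix.mulVec, dotProduct, Pi.zero_apply]
      simp_rw [mul_comm (borderedMatrix x t i _)]
      refine Fin.cases ?_ (fun l => ?_) i
      · simpa [borderedMatrix, h0] using hsum fun _ => 1
      · have h2 := congrArg (fun v : EuclideanSpace ℝ (Fin d) => v l) h1
        simp only [WithLp.ofLp_sum, Finset.sum_apply, PiLp.smul_apply, smul_eq_mul,
          PiLp.zero_apply] at h2
        have h3 := hsum fun τ => x τ l
        rw [h2] at h3
        simpa [borderedMatrix] using h3)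
  intro τ hτ
  have hτ' : τ ∈ Set.range t := by
    have := T'.range_orderEmbOfFin hT'card
    rw [this]
    exact hTT' hτ
  obtain ⟨j, rfl⟩ := hτ'
  simpa [hτ] using congrFun hzero j

/-- Two representations of a point involve at most `2k + m + 1` parameters: `0`, both families of
`k` nodes, and `1` if `m = 1`. Affine independence makes their masses agree; the nodes are then the
parameters in `(0, 1)` with positive mass. If `m = 1`, both ends may occur, which is harmless
because the dimension is odd and the path is not closed. -/
theorem injOn_nodePoint {k m : ℕ} {x : ℝ → EuclideanSpace ℝ (Fin (2 * k + m))}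
    (hx : IsDOrderPath x) (hm : m ≤ 1) : Set.InjOn (nodePoint x) (nodeDomain k m) := by
  classical
  have key : ∀ w ∈ nodeDomain k m, ∀ w' ∈ nodeDomain k m, nodePoint x w = nodePoint x w' →
      (∀ i, nodeMass w (w (Sum.inr i)) = nodeMass w' (w (Sum.inr i))) ∧
      (m = 1 → nodeMass w 1 = nodeMass w' 1) := by
    intro w hw w' hw' heq
    let T : Finset ℝ := insert 0 (Finset.univ.image (upperNode m fun i => w (Sum.inr i)) ∪
      Finset.univ.image fun i => w' (Sum.inr i))
    have hT0 : (0 : ℝ) ∈ T := Finset.mem_insert_self _ _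
    have hTw : ∀ c, upperNode m (fun i => w (Sum.inr i)) c ∈ T := fun c =>
      Finset.mem_insert_of_mem (Finset.mem_union_left _ (Finset.mem_image_of_mem _ (Finset.mem_univ c)))
    have hTw' : ∀ c, upperNode m (fun i => w' (Sum.inr i)) c ∈ T := by
      rintro (i | j)
      · exact Finset.mem_insert_of_mem (Finset.mem_union_right _
          (Finset.mem_image_of_mem _ (Finset.mem_univ i)))
      · exact hTw (Sum.inr j)
    have hcard : T.card ≤ 2 * k + m + 1 := by
      refine (Finset.card_insert_le _ _).trans ?_
      have h1 := Finset.card_union_le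
        (Finset.univ.image (upperNode m fun i => w (Sum.inr i)))
        (Finset.univ.image fun i => w' (Sum.inr i))
      have h2 := Finset.card_image_le (s := Finset.univ)
        (f := upperNode m fun i => w (Sum.inr i))
      have h3 := Finset.card_image_le (s := Finset.univ) (f := fun i => w' (Sum.inr i))
      simp only [Finset.card_univ, Fintype.card_sum, Fintype.card_fin] at h2 h3
      omega
    have hTmem : ∀ τ ∈ T, τ = 0 ∨ τ ∈ Set.Ioo (0 : ℝ) 1 ∨ (τ = 1 ∧ m ≠ 0) := by
      intro τ hτ
      simp only [T, Finset.mem_insert, Finset.mem_union, Finset.mem_image, Finset.mem_univ,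
        true_and] at hτ
      rcases hτ with h | ⟨c | j, rfl⟩ | ⟨i, rfl⟩
      · exact Or.inl h
      · exact Or.inr (Or.inl (hw.2.2 c))
      · exact Or.inr (Or.inr ⟨rfl, by have := j.2; omega⟩)
      · exact Or.inr (Or.inl (hw'.2.2 i))
    have hzero := hx.eq_zero_of_sum_eq_zero (T := T) (fun τ hτ => by
        rcases hTmem τ hτ with rfl | h | ⟨rfl, -⟩
        · simp
        · exact Set.Ioo_subset_Icc_self h
        · simp) hcard
      (by
        by_cases hm0 : m = 0
        · refine Or.inr fun τ hτ => ?_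
          rcases hTmem τ hτ with rfl | h | ⟨rfl, h⟩
          · exact zero_lt_one
          · exact h.2
          · exact (h hm0).elim
        · exact Or.inl (hx.apply_zero_ne_apply_one ⟨k, by omega⟩))
      (fun τ => nodeMass w τ - nodeMass w' τ)
      (by
        have h1 := sum_nodeMass_smul w (fun _ => (1 : ℝ)) T hT0 hTw
        have h2 := sum_nodeMass_smul w' (fun _ => (1 : ℝ)) T hT0 hTw'
        simp only [smul_eq_mul, mul_one, nodePoint, sub_self, mul_zero,
          Finset.sum_const_zero, add_zero] at h1 h2
        rw [Finset.sum_sub_distrib, h1, h2, sub_self])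
      (by
        simp_rw [sub_smul]
        rw [Finset.sum_sub_distrib, sum_nodeMass_smul w x T hT0 hTw,
          sum_nodeMass_smul w' x T hT0 hTw', heq, sub_self])
    refine ⟨fun i => sub_eq_zero.1 (hzero _ (hTw (Sum.inl i))), ?_⟩
    rintro rfl
    exact sub_eq_zero.1 (hzero _ (hTw (Sum.inr 0)))
  have hsub : ∀ w ∈ nodeDomain k m, ∀ w' ∈ nodeDomain k m, nodePoint x w = nodePoint x w' →
      Set.range (fun i => w (Sum.inr i)) ⊆ Set.range (fun i => w' (Sum.inr i)) := by
    rintro w hw w' hw' heq _ ⟨i, rfl⟩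
    refine exists_eq_of_nodeMass_ne_zero (hw.2.2 i) ?_
    rw [← (key w hw w' hw' heq).1 i, nodeMass_node hw]
    exact (hw.1.1 _).ne'
  intro w hw w' hw' heq
  have hs : (fun i => w (Sum.inr i)) = fun i => w' (Sum.inr i) :=
    (hw.2.1.range_inj hw'.2.1).1 ((hsub w hw w' hw' heq).antisymm (hsub w' hw' w hw heq.symm))
  obtain ⟨h1, h2⟩ := key w hw w' hw' heq
  ext ((i | j) | i)
  · rw [← nodeMass_node hw, h1, congrFun hs i, nodeMass_node hw']
  · obtain rfl : m = 1 := by have := j.2; omega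
    have h3 := h2 rfl
    rw [nodeMass_one hw, nodeMass_one hw'] at h3
    obtain rfl : j = 0 := Subsingleton.elim _ _
    simpa using h3
  · exact congrFun hs i

end IsDOrderPath

/-! ### Existence of representations on the interior of the hull. -/

/-- By Carathéodory, the hull is a continuous image of a standard simplex times `s ^ n` with `n =
dim E + 1`; shorter combinations are padded by `s₀` with weight zero. -/
theorem IsCompact.convexHull_of_finiteDimensional {E : Type*} [AddCommGroup E] [Module ℝ E]
    [TopologicalSpace E] [IsTopologicalAddGroup E] [ContinuousSMul ℝ E] [FiniteDimensional ℝ E]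
    {s : Set E} (hs : IsCompact s) : IsCompact (convexHull ℝ s) := by
  rcases s.eq_empty_or_nonempty with rfl | ⟨s₀, hs₀⟩
  · simp
  let n := Module.finrank ℝ E + 1
  have himage : convexHull ℝ s = (fun p : (Fin n → ℝ) × (Fin n → E) => ∑ i, p.1 i • p.2 i) ''
      (stdSimplex ℝ (Fin n) ×ˢ Set.univ.pi fun _ => s) := by
    refine Set.Subset.antisymm (fun y hy => ?_) ?_
    · obtain ⟨ι, _, z, w, hz, hind, hw, hw1, rfl⟩ := eq_pos_convex_span_of_mem_convexHull hy
      have hcard : Fintype.card ι ≤ Fintype.card (Fin n) := by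
        rw [Fintype.card_fin]
        refine hind.card_le_finrank_succ.trans (Nat.add_le_add_right ?_ 1)
        exact Submodule.finrank_le _
      obtain ⟨j⟩ := Function.Embedding.nonempty_of_card_le hcard
      have hext : ∀ i ∉ Set.range j, Function.extend j w 0 i = 0 := fun i hi => by
        rw [Function.extend_apply' _ _ _ (by simpa using hi)]
        rfl
      refine ⟨(Function.extend j w 0, Function.extend j z fun _ => s₀), ⟨⟨fun i => ?_, ?_⟩,
        fun i _ => ?_⟩, ?_⟩
      · by_cases hi : i ∈ Set.range j
        · obtain ⟨a, rfl⟩ := hi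
          simpa [j.injective.extend_apply] using (hw a).le
        · exact (hext i hi).ge
      · rw [← hw1]
        exact (Fintype.sum_of_injective j j.injective _ _ hext
          fun a => (j.injective.extend_apply _ _ a).symm).symm
      · by_cases hi : i ∈ Set.range j
        · obtain ⟨a, rfl⟩ := hi
          simpa [j.injective.extend_apply] using hz ⟨a, rfl⟩
        · simpa [Function.extend_apply' _ _ _ hi] using hs₀
      · refine (Fintype.sum_of_injective j j.injective _ _ (fun i hi => ?_) fun a => ?_).symm
        · simp [hext i hi]
        · simp [j.injective.extend_apply]
    · rintro _ ⟨⟨w, g⟩, ⟨⟨hw, hw1⟩, hg⟩, rfl⟩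
      exact (convex_convexHull ℝ s).sum_mem (fun i _ => hw i) hw1
        fun i _ => subset_convexHull ℝ s (hg i trivial)
  rw [himage]
  refine ((isCompact_stdSimplex ℝ _).prod (isCompact_univ_pi fun _ => hs)).image ?_
  fun_prop

namespace IsDOrderPath

section zeros

variable {d : ℕ} {x : ℝ → EuclideanSpace ℝ (Fin d)}

theorem finite_zeros (hx : IsDOrderPath x) {v : Fin (d + 1) → ℝ} (hv : v ≠ 0) :
    {τ ∈ Set.Icc (0 : ℝ) 1 | v 0 + ∑ l : Fin d, v l.succ * x τ l = 0}.Finite := by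
  by_contra hinf
  -- Without `0` the chain avoids the left end, so the determinant is positive even for a closed
  -- path.
  have hinf' := (Set.Infinite.sdiff hinf (Set.finite_singleton (0 : ℝ)))
  obtain ⟨T, hT, hcard⟩ := hinf'.exists_subset_card_eq (d + 1)
  let t := T.orderEmbOfFin hcard
  have htm : ∀ j, t j ∈ T := fun j => T.orderEmbOfFin_mem hcard j
  have hdet := hx.det_pos (t := t) t.strictMono (fun j => (hT (htm j)).1.1)
    (Or.inr (Or.inl ((hT (htm 0)).1.1.1.lt_of_ne' (hT (htm 0)).2)))
  refine hv (Matrix.eq_zero_of_vecMul_eq_zero hdet.ne' ?_)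
  ext j
  simpa [Matrix.vecMul, dotProduct, borderedMatrix, Fin.sum_univ_succ] using (hT (htm j)).1.2

/-- An affine function that is nonnegative on the path cannot vanish at every second one of
`d + 2` nodes and be positive at the first. -/
theorem false_of_alternating_zeros (hx : IsDOrderPath x) {v : Fin (d + 1) → ℝ}
    (hnonneg : ∀ τ ∈ Set.Icc (0 : ℝ) 1, 0 ≤ v 0 + ∑ l : Fin d, v l.succ * x τ l)
    {s : Fin (d + 2) → ℝ} (hs : StrictMono s) (hmem : ∀ i, s i ∈ Set.Ioc (0 : ℝ) 1)
    (hodd : ∀ i : Fin (d + 2), Odd (i : ℕ) → v 0 + ∑ l : Fin d, v l.succ * x (s i) l = 0)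
    (hpos : 0 < v 0 + ∑ l : Fin d, v l.succ * x (s 0) l) : False := by
  -- In this alternating relation between the `d + 2` columns, the odd terms vanish by `hodd`, the
  -- even ones are nonnegative, and the first is positive.
  have h := sum_neg_one_pow_mul_det_succAbove (Matrix.of fun (i : Fin (d + 1)) (j : Fin (d + 2)) =>
    (Fin.cons 1 (fun k : Fin d => x (s j) k) : Fin (d + 1) → ℝ) i) v
  have hdet : ∀ j : Fin (d + 2), 0 < ((Matrix.of fun (i : Fin (d + 1)) (j : Fin (d + 2)) =>
      (Fin.cons 1 (fun k : Fin d => x (s j) k) : Fin (d + 1) → ℝ) i).submatrix id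
        j.succAbove).det := fun j =>
    hx.det_pos (t := s ∘ j.succAbove) (hs.comp (Fin.strictMono_succAbove j))
      (fun i => Set.Ioc_subset_Icc_self (hmem _)) (Or.inr (Or.inl (hmem _).1))
  have hrow : ∀ j : Fin (d + 2), (∑ r, v r * (Matrix.of fun (i : Fin (d + 1)) (j : Fin (d + 2)) =>
      (Fin.cons 1 (fun k : Fin d => x (s j) k) : Fin (d + 1) → ℝ) i) r j) =
      v 0 + ∑ l : Fin d, v l.succ * x (s j) l := by
    intro j
    simp [Fin.sum_univ_succ]
  refine h.not_gt (Finset.sum_pos' (fun j _ => ?_) ⟨0, Finset.mem_univ _, ?_⟩)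
  · rw [hrow]
    rcases Nat.even_or_odd (j : ℕ) with he | ho
    · rw [he.neg_one_pow, one_mul]
      exact mul_nonneg (hnonneg _ (Set.Ioc_subset_Icc_self (hmem j))) (hdet j).le
    · rw [hodd j ho]
      simp
  · rw [hrow]
    simpa using mul_pos hpos (hdet 0)

end zeros

variable {k m : ℕ} {x : ℝ → EuclideanSpace ℝ (Fin (2 * k + m))}

/-- A nonzero affine function that is nonnegative on the path has at most `k` zeros in `(0, 1]`
in even dimension `2 * k`, and at most `k` zeros in `(0, 1)` in odd dimension `2 * k + 1`. -/
theorem card_zeros_le (hx : IsDOrderPath x) (hm : m ≤ 1) {v : Fin (2 * k + m + 1) → ℝ}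
    (hv : v ≠ 0)
    (hnonneg : ∀ τ ∈ Set.Icc (0 : ℝ) 1, 0 ≤ v 0 + ∑ l : Fin (2 * k + m), v l.succ * x τ l)
    {T : Finset ℝ} (hT : ∀ τ ∈ T, τ ∈ Set.Ioc (0 : ℝ) 1 ∧ (m = 1 → τ < 1) ∧
      v 0 + ∑ l : Fin (2 * k + m), v l.succ * x τ l = 0) : T.card ≤ k := by
  by_contra! hlt
  obtain ⟨T', hT'T, hcard⟩ := Finset.exists_subset_card_eq (Nat.succ_le_of_lt hlt)
  let z := T'.orderEmbOfFin hcard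
  have hz : ∀ j, z j ∈ Set.Ioc (0 : ℝ) 1 ∧ (m = 1 → z j < 1) ∧
      v 0 + ∑ l : Fin (2 * k + m), v l.succ * x (z j) l = 0 :=
    fun j => hT _ (hT'T (T'.orderEmbOfFin_mem hcard j))
  obtain ⟨u, hu, huz⟩ := ((Set.Ioo_infinite (hz 0).1.1).sdiff (hx.finite_zeros hv)).nonempty
  have hu1 : u ≤ 1 := hu.2.le.trans (hz 0).1.2
  have hupos : 0 < v 0 + ∑ l : Fin (2 * k + m), v l.succ * x u l :=
    (hnonneg u ⟨hu.1.le, hu1⟩).lt_of_ne' fun h => huz ⟨⟨hu.1.le, hu1⟩, h⟩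
  -- The sequence `2u - z_0, z_0, …, z_k, 1`. Its first entry is chosen so that the midpoint of the
  -- first two is `u`.
  let g : ℕ → ℝ := fun i => if i = 0 then 2 * u - z 0 else
    if h : i - 1 < k + 1 then z ⟨i - 1, h⟩ else 1
  have hg0 : g 0 = 2 * u - z 0 := by simp [g]
  have hgs : ∀ i (h : i < k + 1), g (i + 1) = z ⟨i, h⟩ := fun i h => by
    simp [g, Nat.lt_succ_iff.1 h]
  have hglast : g (k + 2) = 1 := by simp [g]
  have hgstep : ∀ i, i < k + 1 + m → g i < g (i + 1) := by
    intro i hi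
    rcases Nat.eq_zero_or_pos i with rfl | hpos
    · rw [hg0, hgs 0 (by omega)]
      have := hu.2
      change 2 * u - z 0 < z 0
      linarith
    · obtain ⟨i, rfl⟩ : ∃ i', i = i' + 1 := ⟨i - 1, by omega⟩
      by_cases hik : i + 1 < k + 1
      · rw [hgs i (by omega), hgs (i + 1) hik]
        exact z.strictMono (Fin.mk_lt_mk.2 (Nat.lt_succ_self i))
      · obtain rfl : i = k := by omega
        rw [hglast, hgs i (by omega)]
        exact (hz _).2.1 (by omega)
  have hgmono : ∀ i j, i < j → j ≤ k + 1 + m → g i < g j := by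
    intro i j hij
    induction j, hij using Nat.le_induction with
    | base => exact fun h => hgstep i (by omega)
    | succ j hij ih => exact fun h => (ih (by omega)).trans (hgstep j (by omega))
  have hgmono' : ∀ i j, i ≤ j → j ≤ k + 1 + m → g i ≤ g j := by
    intro i j hij hj
    rcases hij.eq_or_lt with rfl | h
    · exact le_rfl
    · exact (hgmono i j h hj).le
  have hg1 : ∀ i, g i ≤ 1 := by
    intro i
    simp only [g]
    split_ifs with h1 h2
    · have := hu.2
      linarith
    · exact (hz _).1.2
    · exact le_rfl
  -- For `j = 2l + 1` both indices are `l + 1` and the value is `z_l`; for `j = 2l` it is the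
  -- midpoint of `g l` and `g (l + 1)`. The entry `1` of `g` is used only for `m = 1`, at `j = 2k +
  -- 2`.
  let s : Fin (2 * k + m + 2) → ℝ := fun j =>
    (g (((j : ℕ) + 1) / 2) + g ((j : ℕ) / 2 + 1)) / 2
  have hs0 : s 0 = u := by
    have h1 : g 1 = z 0 := hgs 0 (by omega)
    simp only [s, Fin.val_zero]
    norm_num
    rw [hg0, h1]
    ring
  have hs : StrictMono s := by
    intro i j hij
    have hij' : (i : ℕ) < j := hij
    have hj := j.2
    simp only [s]
    have h1 := hgmono' (((i : ℕ) + 1) / 2) (((j : ℕ) + 1) / 2) (by omega) (by omega)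
    have h2 := hgmono' ((i : ℕ) / 2 + 1) ((j : ℕ) / 2 + 1) (by omega) (by omega)
    rcases Nat.lt_or_ge (((i : ℕ) + 1) / 2) (((j : ℕ) + 1) / 2) with h | h
    · have := hgmono _ _ h (by omega)
      linarith
    · have := hgmono ((i : ℕ) / 2 + 1) ((j : ℕ) / 2 + 1) (by omega) (by omega)
      linarith
  refine hx.false_of_alternating_zeros hnonneg hs (fun i => ⟨?_, ?_⟩) ?_ (hs0 ▸ hupos)
  · have := hs.monotone (Fin.zero_le i)
    rw [hs0] at this
    exact hu.1.trans_le this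
  · have h1 := hg1 (((i : ℕ) + 1) / 2)
    have h2 := hg1 ((i : ℕ) / 2 + 1)
    simp only [s]
    linarith
  · intro i hi
    have hlt := i.2
    obtain ⟨l, hl⟩ := hi
    have h1 : ((i : ℕ) + 1) / 2 = l + 1 := by omega
    have h2 : (i : ℕ) / 2 + 1 = l + 1 := by omega
    have h3 : s i = z ⟨l, by omega⟩ := by
      simp only [s, h1, h2]
      rw [hgs l (by omega)]
      ring
    rw [h3]
    exact (hz _).2.2

/-- A combination of at most `k` points of the path with the end points can be written with
exactly `k` nodes. -/
theorem exists_nodePoint_eq (x : ℝ → EuclideanSpace ℝ (Fin (2 * k + m))) {T : Finset ℝ}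
    (hT : ∀ τ ∈ T, τ ∈ Set.Icc (0 : ℝ) 1) (hcard : T.card ≤ k) {a : ℝ → ℝ} (ha : ∀ τ, 0 ≤ a τ)
    {b : ℝ} (hb : 0 ≤ b) (hsum : ∑ τ ∈ T, a τ + m * b ≤ 1) :
    ∃ w ∈ closedNodeDomain k m, nodePoint x w =
      x 0 + (∑ τ ∈ T, a τ • (x τ - x 0) + (m * b) • (x 1 - x 0)) := by
  classical
  obtain ⟨S, hTS, hS, hScard⟩ := (Set.Icc_infinite (zero_lt_one' ℝ)).exists_finset_superset_card_eq
    (T := T) (fun τ hτ => hT τ hτ) hcard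
  let s := S.orderEmbOfFin hScard
  have key : ∀ {E : Type} [AddCommGroup E] [Module ℝ E] (g : ℝ → E),
      ∑ i, (if s i ∈ T then a (s i) else 0) • g (s i) = ∑ τ ∈ T, a τ • g τ := by
    intro E _ _ g
    have h2 := Finset.sum_map Finset.univ s.toEmbedding
      (fun τ => (if τ ∈ T then a τ else 0) • g τ)
    rw [Finset.map_orderEmbOfFin_univ S hScard] at h2
    refine h2.symm.trans ?_
    simp only [ite_smul, zero_smul, ← Finset.sum_filter]
    rw [Finset.filter_mem_eq_inter, Finset.inter_eq_right.2 hTS]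
  -- Nodes outside `T` only complete the number `k` and get weight zero, which the closed domain
  -- allows.
  refine ⟨Sum.elim (Sum.elim (fun i => if s i ∈ T then a (s i) else 0) fun _ => b) s,
    ⟨⟨?_, ?_⟩, s.strictMono, fun i => hS (S.orderEmbOfFin_mem hScard i)⟩, ?_⟩
  · rintro (i | j)
    · simp only [Sum.elim_inl]
      split_ifs
      · exact ha _
      · exact le_rfl
    · exact hb
  · have := key fun _ => (1 : ℝ)
    simp only [smul_eq_mul, mul_one] at this
    simpa [this] using hsum
  · have := key fun τ => x τ - x 0
    simpa [nodePoint, upperNode, mul_smul, Nat.cast_smul_eq_nsmul] using this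

/-- Every interior point of the convex hull is represented by nonnegative weights at `k` nodes and
the end points. -/
theorem interior_convexHull_subset (hx : IsDOrderPath x) (hm : m ≤ 1) :
    interior (convexHull ℝ (x '' Set.Icc 0 1)) ⊆ nodePoint x '' closedNodeDomain k m := by
  classical
  intro p hp
  set C := convexHull ℝ (x '' Set.Icc 0 1) with hC
  have hCconv : Convex ℝ C := convex_convexHull ℝ _
  have hCcomp : IsCompact C :=
    (isCompact_Icc.image_of_continuousOn hx.continuousOn).convexHull_of_finiteDimensional
  have h0C : x 0 ∈ C := subset_convexHull ℝ _ ⟨0, by simp, rfl⟩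
  by_cases hp0 : p = x 0
  · obtain ⟨w, hw, hwe⟩ := exists_nodePoint_eq (k := k) x (T := ∅) (by simp) (by simp)
      (a := fun _ => 0) (fun _ => le_rfl) (b := 0) le_rfl (by simp)
    exact ⟨w, hw, by simpa [hp0] using hwe⟩
  -- the point `q` where the ray from `x 0` through `p` leaves the convex hull
  obtain ⟨r, hr1, hqC, hqint⟩ : ∃ r : ℝ, 1 ≤ r ∧ x 0 + r • (p - x 0) ∈ C ∧
      x 0 + r • (p - x 0) ∉ interior C := by
    have hcont : Continuous fun r : ℝ => x 0 + r • (p - x 0) := by fun_prop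
    let R : Set ℝ := {r | x 0 + r • (p - x 0) ∈ C}
    have h1R : (1 : ℝ) ∈ R := by
      have : p ∈ C := interior_subset hp
      simpa [R] using this
    have hRclosed : IsClosed R := hCcomp.isClosed.preimage hcont
    have hRbdd : BddAbove R := by
      obtain ⟨M, hM⟩ := hCcomp.isBounded.exists_norm_le
      have hpos : 0 < ‖p - x 0‖ := norm_pos_iff.2 (sub_ne_zero.2 hp0)
      refine ⟨(M + ‖x 0‖) / ‖p - x 0‖, fun r hr => ?_⟩
      rw [le_div_iff₀ hpos]
      have h1 : ‖r • (p - x 0)‖ ≤ ‖x 0 + r • (p - x 0)‖ + ‖x 0‖ := by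
        have := norm_sub_le (x 0 + r • (p - x 0)) (x 0)
        simpa using this
      have h2 := hM _ hr
      rw [norm_smul] at h1
      have h3 : r * ‖p - x 0‖ ≤ ‖r‖ * ‖p - x 0‖ :=
        mul_le_mul_of_nonneg_right (le_abs_self r) hpos.le
      linarith
    have hsup : sSup R ∈ R := hRclosed.csSup_mem ⟨1, h1R⟩ hRbdd
    refine ⟨sSup R, le_csSup hRbdd h1R, hsup, fun hint => ?_⟩
    have hnhds : ∀ᶠ r in nhds (sSup R), x 0 + r • (p - x 0) ∈ interior C :=
      hcont.continuousAt.eventually (isOpen_interior.mem_nhds hint)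
    obtain ⟨r, hr, hrlt⟩ := ((hnhds.filter_mono nhdsWithin_le_nhds).and
      (self_mem_nhdsWithin (s := Set.Ioi (sSup R)))).exists
    exact (le_csSup hRbdd (interior_subset hr : _ ∈ C)).not_gt hrlt
  set q := x 0 + r • (p - x 0) with hq
  obtain ⟨f, hf⟩ := geometric_hahn_banach_open_point hCconv.interior isOpen_interior hqint
  have hfC : ∀ y ∈ C, f y ≤ f q := by
    intro y hy
    have hy' : y ∈ closure (interior C) := by
      rw [hCconv.closure_interior_eq_closure_of_nonempty_interior ⟨p, hp⟩]
      exact subset_closure hy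
    exact closure_minimal (fun a ha => (hf a ha).le)
      (isClosed_le f.continuous continuous_const) hy'
  -- Coefficients of the affine function `f q - f`, nonnegative on the hull, zero at `q` and
  -- positive at `p`.
  let v : Fin (2 * k + m + 1) → ℝ :=
    Fin.cons (f q) fun l => -f (EuclideanSpace.single l 1)
  have hfy : ∀ y : EuclideanSpace ℝ (Fin (2 * k + m)),
      v 0 + ∑ l : Fin (2 * k + m), v l.succ * y l = f q - f y := by
    intro y
    have hy : y = ∑ l, y l • EuclideanSpace.single l (1 : ℝ) := by
      ext i
      simp [Finset.sum_apply, Pi.single_apply]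
    conv_rhs => rw [hy, map_sum]
    simp [v, mul_comm, sub_eq_add_neg]
  have hv : v ≠ 0 := by
    intro hv
    have := hfy p
    simp only [hv, Pi.zero_apply, zero_mul, Finset.sum_const_zero, add_zero] at this
    have := hf p hp
    linarith
  have hnonneg : ∀ τ ∈ Set.Icc (0 : ℝ) 1,
      0 ≤ v 0 + ∑ l : Fin (2 * k + m), v l.succ * x τ l := by
    intro τ hτ
    rw [hfy, sub_nonneg]
    exact hfC _ (subset_convexHull ℝ _ ⟨τ, hτ, rfl⟩)
  let Z := (hx.finite_zeros hv).toFinset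
  have hZ : ∀ {τ}, τ ∈ Z ↔ τ ∈ Set.Icc (0 : ℝ) 1 ∧
      v 0 + ∑ l : Fin (2 * k + m), v l.succ * x τ l = 0 := by
    intro τ
    exact (hx.finite_zeros hv).mem_toFinset
  -- `q` is a convex combination of the points on the supporting hyperplane
  obtain ⟨a, ha, ha1, haq⟩ : ∃ a : ℝ → ℝ, (∀ τ, 0 ≤ a τ) ∧ ∑ τ ∈ Z, a τ = 1 ∧
      ∑ τ ∈ Z, a τ • x τ = q := by
    have hqC' := hqC
    rw [hC, convexHull_eq] at hqC'
    obtain ⟨ι, t, w, z, hw, hw1, hz, hqz⟩ := hqC'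
    rw [Finset.centerMass_eq_of_sum_1 _ _ hw1] at hqz
    have hz' : ∀ i, ∃ τ, i ∈ t → τ ∈ Set.Icc (0 : ℝ) 1 ∧ x τ = z i := by
      intro i
      by_cases hi : i ∈ t
      · obtain ⟨τ, h⟩ := hz i hi
        exact ⟨τ, fun _ => h⟩
      · exact ⟨0, fun h => (hi h).elim⟩
    choose τ hτ using hz'
    -- Nonnegative terms with sum `f q - f q = 0`: only points on the supporting hyperplane carry
    -- weight.
    have hzero : ∀ i ∈ t, w i * (f q - f (z i)) = 0 := by
      refine (Finset.sum_eq_zero_iff_of_nonneg fun i hi => mul_nonneg (hw i hi)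
        (sub_nonneg.2 (hfC _ (subset_convexHull ℝ _ (hz i hi))))).1 ?_
      have hfq : f q = ∑ i ∈ t, w i * f (z i) := by
        conv_lhs => rw [← hqz]
        simp [map_sum]
      simp_rw [mul_sub]
      rw [Finset.sum_sub_distrib, ← Finset.sum_mul, hw1, one_mul, ← hfq, sub_self]
    let t' := t.filter fun i => w i ≠ 0
    have hmaps : ∀ i ∈ t', τ i ∈ Z := by
      intro i hi
      obtain ⟨hit, hwi⟩ := Finset.mem_filter.1 hi
      refine hZ.2 ⟨(hτ i hit).1, ?_⟩
      rw [hfy, (hτ i hit).2]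
      exact (mul_eq_zero.1 (hzero i hit)).resolve_left hwi
    refine ⟨fun σ => ∑ i ∈ t' with τ i = σ, w i, fun σ => Finset.sum_nonneg fun i hi =>
      hw i (Finset.mem_filter.1 (Finset.mem_filter.1 hi).1).1, ?_, ?_⟩
    · rw [Finset.sum_fiberwise_of_maps_to hmaps, ← hw1]
      exact Finset.sum_filter_ne_zero _
    · have h1 : ∀ σ ∈ Z, (∑ i ∈ t' with τ i = σ, w i) • x σ =
          ∑ i ∈ t' with τ i = σ, w i • z i := by
        intro σ _
        rw [Finset.sum_smul]
        refine Finset.sum_congr rfl fun i hi => ?_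
        obtain ⟨hi', rfl⟩ := Finset.mem_filter.1 hi
        rw [(hτ i (Finset.mem_filter.1 hi').1).2]
      rw [Finset.sum_congr rfl h1, Finset.sum_fiberwise_of_maps_to hmaps, ← hqz]
      refine Finset.sum_subset (Finset.filter_subset _ _) fun i hi hi' => ?_
      have : w i = 0 := by
        by_contra h
        exact hi' (Finset.mem_filter.2 ⟨hi, h⟩)
      simp [this]
  have hr0 : 0 < r := zero_lt_one.trans_le hr1
  -- Since `p - x 0 = r⁻¹ • (q - x 0)`, the weights shrink by `r⁻¹ ≤ 1` and the mass left over goes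
  -- to `x 0`.
  have hp_eq : p = x 0 + ∑ τ ∈ Z, (r⁻¹ * a τ) • (x τ - x 0) := by
    have h1 : ∑ τ ∈ Z, (r⁻¹ * a τ) • (x τ - x 0) = r⁻¹ • (q - x 0) := by
      simp_rw [mul_smul]
      rw [← Finset.smul_sum]
      simp_rw [smul_sub]
      rw [Finset.sum_sub_distrib, haq, ← Finset.sum_smul, ha1, one_smul, smul_sub]
    rw [h1, hq, add_sub_cancel_left, smul_smul, inv_mul_cancel₀ hr0.ne', one_smul,
      add_sub_cancel]
  have hra : ∀ τ, 0 ≤ r⁻¹ * a τ := fun τ => mul_nonneg (inv_nonneg.2 hr0.le) (ha τ)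
  have hrsum : ∑ τ ∈ Z, r⁻¹ * a τ ≤ 1 := by
    rw [← Finset.mul_sum, ha1, mul_one]
    exact inv_le_one_of_one_le₀ hr1
  -- Contacts at `0` (and at `1` if `m = 1`) need no node, as those points belong to every
  -- representation; at most `k` others remain.
  let T := Z.filter fun τ => τ ≠ 0 ∧ (m = 1 → τ ≠ 1)
  have hT : ∀ τ ∈ T, τ ∈ Set.Ioc (0 : ℝ) 1 ∧ (m = 1 → τ < 1) ∧
      v 0 + ∑ l : Fin (2 * k + m), v l.succ * x τ l = 0 := by
    intro τ hτ
    obtain ⟨h1, h2, h3⟩ := Finset.mem_filter.1 hτ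
    obtain ⟨h4, h5⟩ := hZ.1 h1
    exact ⟨⟨h4.1.lt_of_ne' h2, h4.2⟩, fun h => h4.2.lt_of_ne (h3 h), h5⟩
  have hcard := hx.card_zeros_le hm hv hnonneg hT
  -- the weight at the end point `1`
  let b : ℝ := if 1 ∈ Z then r⁻¹ * a 1 else 0
  have hb : 0 ≤ b := by
    simp only [b]
    split_ifs
    · exact hra 1
    · exact le_rfl
  -- Used with `g = 1` to bound the total weight, and with `g τ = x τ - x 0`, where the term at `0`
  -- disappears.
  have hsplit : ∀ {E : Type} [AddCommGroup E] [Module ℝ E] (g : ℝ → E),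
      ∑ τ ∈ Z, (r⁻¹ * a τ) • g τ = ∑ τ ∈ T, (r⁻¹ * a τ) • g τ + (m * b) • g 1 +
        (if 0 ∈ Z then (r⁻¹ * a 0) • g 0 else 0) := by
    intro E _ _ g
    have h1 : ∀ τ ∈ Z, (r⁻¹ * a τ) • g τ =
        (if τ ≠ 0 ∧ (m = 1 → τ ≠ 1) then (r⁻¹ * a τ) • g τ else 0) +
        (if τ = 1 then (m : ℝ) • (r⁻¹ * a τ) • g τ else 0) +
        (if τ = 0 then (r⁻¹ * a τ) • g τ else 0) := by
      intro τ _
      by_cases h0 : τ = 0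
      · simp [h0]
      · by_cases h1 : τ = 1
        · have : m = 0 ∨ m = 1 := by omega
          rcases this with h | h <;> simp [h1, h]
        · simp [h0, h1]
    rw [Finset.sum_congr rfl h1, Finset.sum_add_distrib, Finset.sum_add_distrib,
      Finset.sum_ite_eq', Finset.sum_ite_eq', ← Finset.sum_filter]
    congr 2
    simp only [b]
    split_ifs <;> simp [mul_smul]
  obtain ⟨w, hw, hwe⟩ := exists_nodePoint_eq (k := k) x (T := T)
    (fun τ hτ => Set.Ioc_subset_Icc_self (hT τ hτ).1) hcard hra hb (by
      have h1 := hsplit fun _ => (1 : ℝ)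
      simp only [smul_eq_mul, mul_one] at h1
      have h2 : (0 : ℝ) ≤ if 0 ∈ Z then r⁻¹ * a 0 else 0 := by
        split_ifs
        · exact hra 0
        · exact le_rfl
      linarith)
  refine ⟨w, hw, ?_⟩
  rw [hwe, hp_eq, hsplit fun τ => x τ - x 0]
  simp

end IsDOrderPath

/-! ### Interleaved coordinates and the sign of the Jacobian. -/

/-- The order in which weights and nodes interleave: `λ₁, s₁, λ₂, s₂, …, λ_k, s_k, μ`. -/
noncomputable def interleave (k m : ℕ) : (Fin k ⊕ Fin m) ⊕ Fin k ≃ Fin (2 * k + m) :=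
  Equiv.ofBijective (Sum.elim (Sum.elim (fun i => ⟨2 * i, by omega⟩) fun j => ⟨2 * k + j, by omega⟩)
    fun i => ⟨2 * i + 1, by omega⟩) <| by
    rw [Fintype.bijective_iff_injective_and_card]
    refine ⟨?_, by simp; ring⟩
    rintro ((i | i) | i) ((j | j) | j) h <;>
      simp only [Sum.elim_inl, Sum.elim_inr, Fin.mk.injEq] at h <;>
      simp only [Sum.inl.injEq, Sum.inr.injEq, reduceCtorEq, Fin.ext_iff] <;> omega

@[simp]
theorem interleave_weight {k m : ℕ} (i : Fin k) :
    (interleave k m (Sum.inl (Sum.inl i)) : ℕ) = 2 * i := rfl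

@[simp]
theorem interleave_last {k m : ℕ} (j : Fin m) :
    (interleave k m (Sum.inl (Sum.inr j)) : ℕ) = 2 * k + j := rfl

@[simp]
theorem interleave_node {k m : ℕ} (i : Fin k) :
    (interleave k m (Sum.inr i) : ℕ) = 2 * i + 1 := rfl

/-- The nodes preceding those of `upperNode`. -/
def lowerNode {k : ℕ} (m : ℕ) (s : Fin k → ℝ) : Fin k ⊕ Fin m → ℝ :=
  Sum.elim (fun i => (Fin.cons 0 s : Fin (k + 1) → ℝ) i.castSucc)
    fun _ => (Fin.cons 0 s : Fin (k + 1) → ℝ) (Fin.last k)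

/-- Characterizes the lower node by the interleaved order, as `0` or the last preceding node, so
that the first weight and the case `k = 0` need no separate treatment later. -/
theorem lowerNode_eq {k m : ℕ} (s : Fin k → ℝ) (c : Fin k ⊕ Fin m) :
    (lowerNode m s c = 0 ∧ ∀ i : Fin k, interleave k m (Sum.inl c) < interleave k m (Sum.inr i)) ∨
      ∃ i : Fin k, lowerNode m s c = s i ∧
        interleave k m (Sum.inr i) < interleave k m (Sum.inl c) ∧
        ∀ j : Fin k, interleave k m (Sum.inr j) < interleave k m (Sum.inl c) → j ≤ i := by
  rcases c with i | j
  · obtain ⟨i, hi⟩ := i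
    rcases i with _ | i
    · refine Or.inl ⟨rfl, fun i => ?_⟩
      rw [Fin.lt_def]
      simp
    · refine Or.inr ⟨⟨i, by omega⟩, rfl, ?_, fun j hj => ?_⟩
      · rw [Fin.lt_def]
        simp
        omega
      · rw [Fin.lt_def] at hj
        rw [Fin.le_def]
        simp at hj ⊢
        omega
  · rcases k with _ | k
    · exact Or.inl ⟨rfl, fun i => i.elim0⟩
    · refine Or.inr ⟨Fin.last k, rfl, ?_, fun j _ => Fin.le_last j⟩
      rw [Fin.lt_def]
      simp
      omega

/-- The path with its coordinates indexed in the interleaved order. -/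
noncomputable def interleavedPath {k m : ℕ} (x : ℝ → EuclideanSpace ℝ (Fin (2 * k + m))) (t : ℝ) :
    (Fin k ⊕ Fin m) ⊕ Fin k → ℝ :=
  fun a => x t (interleave k m a)

/-- The matrix with columns `y (s i) - y 0`, `y 1 - y 0` and `y' (s i)`. -/
def nodeMatrix {k m : ℕ} (y y' : ℝ → (Fin k ⊕ Fin m) ⊕ Fin k → ℝ) (s : Fin k → ℝ) :
    Matrix ((Fin k ⊕ Fin m) ⊕ Fin k) ((Fin k ⊕ Fin m) ⊕ Fin k) ℝ :=
  Matrix.of fun a b =>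
    Sum.elim (fun c => y (upperNode m s c) a - y 0 a) (fun i => y' (s i) a) b

/-- The differences to the initial point may be replaced by the differences between consecutive
nodes. -/
theorem det_nodeMatrix_eq {k m : ℕ} (y y' : ℝ → (Fin k ⊕ Fin m) ⊕ Fin k → ℝ) (s : Fin k → ℝ) :
    (Matrix.of fun a b => Sum.elim (fun c => y (upperNode m s c) a - y (lowerNode m s c) a)
      (fun i => y' (s i) a) b : Matrix _ _ ℝ).det = (nodeMatrix y y' s).det := by
  refine Matrix.det_eq_of_col_sub_mem_span_of_equiv (interleave k m) _ _ ?_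
  rintro (c | i)
  · rcases lowerNode_eq s c with ⟨h, -⟩ | ⟨i, h, hlt, -⟩
    · convert Submodule.zero_mem _ using 1
      ext a
      simp [nodeMatrix, h]
    · have : (fun a => (Matrix.of fun a b => Sum.elim
          (fun c => y (upperNode m s c) a - y (lowerNode m s c) a)
          (fun i => y' (s i) a) b : Matrix _ _ ℝ) a (Sum.inl c) -
            nodeMatrix y y' s a (Sum.inl c)) =
          (-1 : ℝ) • fun a => nodeMatrix y y' s a (Sum.inl (Sum.inl i)) := by
        ext a
        simp [nodeMatrix, h, upperNode]
      rw [this]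
      refine Submodule.smul_mem _ _ (Submodule.subset_span ⟨_, ?_, rfl⟩)
      refine lt_trans ?_ hlt
      rw [Fin.lt_def]
      simp
  · convert Submodule.zero_mem _ using 1
    ext a
    simp [nodeMatrix]

/-- Replace each derivative by a difference quotient with small `ε > 0`. Up to the factor `ε⁻¹ ^ k`
and column operations, the result is the bordered determinant of the chain `0 < s_1 < s_1 + ε < s_2
< ⋯`, followed by `1` if `m = 1`. Rows and columns are reindexed alike, so no sign appears. -/
theorem IsDOrderPath.det_nodeMatrix_nonneg {k m : ℕ}
    {x : ℝ → EuclideanSpace ℝ (Fin (2 * k + m))} (hx : IsDOrderPath x) (hm : m ≤ 1)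
    {s : Fin k → ℝ} (hs : StrictMono s) (hmem : ∀ i, s i ∈ Set.Ioo (0 : ℝ) 1)
    {y' : ℝ → (Fin k ⊕ Fin m) ⊕ Fin k → ℝ}
    (hy' : ∀ i, HasDerivAt (interleavedPath x) (y' (s i)) (s i)) :
    0 ≤ (nodeMatrix (interleavedPath x) y' s).det := by
  let y := interleavedPath x
  let Q : ℝ → ℝ → (Fin k ⊕ Fin m) ⊕ Fin k → ℝ := fun ε t => ε⁻¹ • (y (t + ε) - y t)
  have hlim : Filter.Tendsto (fun ε : ℝ => (nodeMatrix y (Q ε) s).det)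
      (nhdsWithin 0 (Set.Ioi 0)) (nhds (nodeMatrix y y' s).det) := by
    have hM : Filter.Tendsto (fun ε : ℝ => nodeMatrix y (Q ε) s)
        (nhdsWithin 0 (Set.Ioi 0)) (nhds (nodeMatrix y y' s)) := by
      refine tendsto_pi_nhds.2 fun a => tendsto_pi_nhds.2 fun b => ?_
      rcases b with c | i
      · exact tendsto_const_nhds
      · have h1 := ((hy' i).tendsto_slope_zero_right).apply_nhds a
        simpa [nodeMatrix, Q] using h1
    exact ((continuous_id.matrix_det).tendsto _).comp hM
  refine ge_of_tendsto hlim ?_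
  have hev1 : ∀ᶠ ε in nhdsWithin (0 : ℝ) (Set.Ioi 0), ∀ i j, i < j → s i + ε < s j := by
    refine Filter.eventually_all.2 fun i => Filter.eventually_all.2 fun j => ?_
    by_cases hij : i < j
    · have h1 : Filter.Tendsto (fun ε => s i + ε) (nhdsWithin (0 : ℝ) (Set.Ioi 0))
          (nhds (s i)) := by
        have : Continuous fun ε => s i + ε := by fun_prop
        simpa using (this.tendsto 0).mono_left nhdsWithin_le_nhds
      filter_upwards [h1.eventually_lt_const (hs hij)] with ε hε _ using hε
    · exact Filter.Eventually.of_forall fun ε h => (hij h).elim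
  have hev2 : ∀ᶠ ε in nhdsWithin (0 : ℝ) (Set.Ioi 0), ∀ i, s i + ε < 1 := by
    refine Filter.eventually_all.2 fun i => ?_
    have h1 : Filter.Tendsto (fun ε => s i + ε) (nhdsWithin (0 : ℝ) (Set.Ioi 0))
        (nhds (s i)) := by
      have : Continuous fun ε => s i + ε := by fun_prop
      simpa using (this.tendsto 0).mono_left nhdsWithin_le_nhds
    exact h1.eventually_lt_const (hmem i).2
  filter_upwards [hev1, hev2, self_mem_nhdsWithin] with ε h1 h2 hε
  have hε : 0 < ε := hε
  -- the nodes in increasing order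
  let T : (Fin k ⊕ Fin m) ⊕ Fin k → ℝ := Sum.elim (upperNode m s) fun i => s i + ε
  have hT : StrictMono (T ∘ (interleave k m).symm) := by
    intro a b hab
    obtain ⟨a, rfl⟩ := (interleave k m).surjective a
    obtain ⟨b, rfl⟩ := (interleave k m).surjective b
    rw [Fin.lt_def] at hab
    simp only [Function.comp_apply, Equiv.symm_apply_apply]
    rcases a with (i | i) | i <;> rcases b with (j | j) | j <;>
      simp [upperNode, T] at hab ⊢
    · exact hs (by omega)
    · exact (hmem i).2
    · rcases (show i ≤ j by omega).eq_or_lt with rfl | h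
      · exact lt_add_of_pos_right _ hε
      · exact (hs h).trans (lt_add_of_pos_right _ hε)
    · omega
    · omega
    · omega
    · exact h1 i j (by omega)
    · exact h2 i
    · exact hs (by omega)
  have hT01 : ∀ a, T a ∈ Set.Ioc (0 : ℝ) 1 := by
    rintro ((i | i) | i)
    · exact Set.Ioo_subset_Ioc_self (hmem i)
    · simp [T, upperNode]
    · exact ⟨add_pos (hmem i).1 hε, (h2 i).le⟩
  have hpos := hx.det_nonneg (t := Fin.cons 0 (T ∘ (interleave k m).symm)) (by
      intro a b hab
      obtain ⟨b, rfl⟩ := Fin.exists_succ_eq.2 (Fin.ne_zero_of_lt hab)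
      induction a using Fin.cases with
      | zero => simpa using (hT01 _).1
      | succ a => simpa using hT (Fin.succ_lt_succ_iff.1 hab))
    (by
      refine fun i => Fin.cases ?_ (fun i => ?_) i
      · simp
      · exact Set.Ioc_subset_Icc_self (hT01 _))
  rw [det_borderedMatrix_eq, ← Matrix.det_submatrix_equiv_self (interleave k m)] at hpos
  have hcol : (nodeMatrix y (fun t => y (t + ε) - y t) s).det =
      (Matrix.of fun a b => y (T b) a - y 0 a).det := by
    refine Matrix.det_eq_of_col_sub_mem_span_of_equiv (interleave k m) _ _ ?_
    rintro (c | i)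
    · convert Submodule.zero_mem _ using 1
      ext a
      simp [nodeMatrix, T]
    · have : (fun a => nodeMatrix y (fun t => y (t + ε) - y t) s a (Sum.inr i) -
          (Matrix.of fun a b => y (T b) a - y 0 a : Matrix _ _ ℝ) a (Sum.inr i)) =
          (-1 : ℝ) • fun a => (Matrix.of fun a b => y (T b) a - y 0 a : Matrix _ _ ℝ) a
            (Sum.inl (Sum.inl i)) := by
        ext a
        simp [nodeMatrix, T, upperNode]
      rw [this]
      refine Submodule.smul_mem _ _ (Submodule.subset_span ⟨_, ?_, rfl⟩)
      change interleave k m _ < interleave k m _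
      rw [Fin.lt_def]
      simp
  have hscale : nodeMatrix y (Q ε) s = Matrix.of fun a b =>
      (Sum.elim (fun _ => 1) (fun _ => ε⁻¹) b : ℝ) *
        nodeMatrix y (fun t => y (t + ε) - y t) s a b := by
    ext a (c | i) <;> simp [nodeMatrix, Q]
  rw [hscale, Matrix.det_mul_row, hcol]
  refine mul_nonneg (Finset.prod_nonneg ?_) ?_
  · rintro (c | i) _
    · exact zero_le_one
    · exact inv_nonneg.2 hε.le
  · refine hpos.trans_eq (congrArg Matrix.det ?_)
    ext a b
    simp [y, interleavedPath]

/-! ### Change of variables. -/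

/-- Lebesgue measure on `ι → ℝ` is the Hausdorff measure of full dimension, which a Lipschitz map
enlarges at most by a constant factor. -/
theorem LipschitzOnWith.volume_image_eq_zero {ι : Type*} [Fintype ι] {f : (ι → ℝ) → ι → ℝ}
    {K : NNReal} {s : Set (ι → ℝ)} (hf : LipschitzOnWith K f s) (hs : volume s = 0) :
    volume (f '' s) = 0 := by
  have h := hf.hausdorffMeasure_image_le (d := (Fintype.card ι : ℝ)) (by positivity)
  rw [hausdorffMeasure_pi_real, hs, mul_zero] at h
  exact le_antisymm h zero_le

theorem volume_setOf_sum_eq_one {κ ι : Type*} [Fintype κ] [Fintype ι] (j : κ → ι) :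
    volume {w : ι → ℝ | ∑ c, w (j c) = 1} = 0 := by
  let L : (ι → ℝ) →ₗ[ℝ] ℝ := ∑ c, LinearMap.proj (j c)
  have hL : ∀ w, L w = ∑ c, w (j c) := fun w => by simp [L]
  let A : AffineSubspace ℝ (ι → ℝ) := (AffineSubspace.mk' (1 : ℝ) ⊥).comap L.toAffineMap
  have hA : (A : Set (ι → ℝ)) = {w : ι → ℝ | ∑ c, w (j c) = 1} := by
    ext w
    simp [A, AffineSubspace.mem_mk', hL, sub_eq_zero]
  rw [← hA]
  refine Measure.addHaar_affineSubspace _ _ fun htop => ?_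
  have h0 : (0 : ι → ℝ) ∈ (A : Set (ι → ℝ)) := by
    rw [htop]
    trivial
  rw [hA] at h0
  simp at h0

section

variable {k m : ℕ} {y : ℝ → (Fin k ⊕ Fin m) ⊕ Fin k → ℝ}

theorem upperNode_mem_Icc {s : Fin k → ℝ} (hs : ∀ i, s i ∈ Set.Icc (0 : ℝ) 1)
    (c : Fin k ⊕ Fin m) : upperNode m s c ∈ Set.Icc (0 : ℝ) 1 := by
  rcases c with i | j
  · exact hs i
  · simp [upperNode]

theorem nodeDomain_subset_closedNodeDomain : nodeDomain k m ⊆ closedNodeDomain k m :=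
  fun _ hw => ⟨⟨fun c => (hw.1.1 c).le, hw.1.2.le⟩, hw.2.1,
    fun i => Set.Ioo_subset_Icc_self (hw.2.2 i)⟩

theorem nodePoint_mem_convexHull {w : (Fin k ⊕ Fin m) ⊕ Fin k → ℝ}
    (hw : w ∈ closedNodeDomain k m) : nodePoint y w ∈ convexHull ℝ (y '' Set.Icc 0 1) := by
  have h := (convex_convexHull ℝ (y '' Set.Icc 0 1)).sum_mem (t := Finset.univ)
    (w := fun o : Option (Fin k ⊕ Fin m) =>
      o.elim (1 - ∑ c, w (Sum.inl c)) fun c => w (Sum.inl c))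
    (z := fun o => o.elim (y 0) fun c => y (upperNode m (fun i => w (Sum.inr i)) c))
    (by
      rintro (_ | c) _
      · exact sub_nonneg.2 hw.1.2
      · exact hw.1.1 c)
    (by simp [Fintype.sum_option])
    (by
      rintro (_ | c) _
      · exact subset_convexHull ℝ _ ⟨0, by simp, rfl⟩
      · exact subset_convexHull ℝ _ ⟨_, upperNode_mem_Icc hw.2.2 c, rfl⟩)
  convert h using 1
  simp only [nodePoint, Fintype.sum_option, Option.elim, smul_sub, Finset.sum_sub_distrib,
    sub_smul, one_smul, Finset.sum_smul]
  abel

theorem exists_lipschitzOnWith_nodePoint {K : NNReal}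
    (hy : LipschitzOnWith K y (Set.Icc 0 1)) :
    ∃ K', LipschitzOnWith K' (nodePoint y) (closedNodeDomain k m) := by
  -- Each summand is a weight in `[0, 1]` times an increment of norm at most `K`; varying either
  -- factor costs one `K`.
  refine ⟨∑ _c : Fin k ⊕ Fin m, (K + K), LipschitzOnWith.of_dist_le_mul fun w hw w' hw' => ?_⟩
  simp only [nodePoint, dist_add_left]
  refine (dist_sum_sum_le _ _ _).trans ?_
  push_cast
  rw [Finset.sum_mul]
  refine Finset.sum_le_sum fun c _ => ?_
  have hu := upperNode_mem_Icc (m := m) hw.2.2 c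
  have hu' := upperNode_mem_Icc (m := m) hw'.2.2 c
  set u := upperNode m (fun i => w (Sum.inr i)) c with hu_def
  set u' := upperNode m (fun i => w' (Sum.inr i)) c with hu'_def
  have huu' : dist u u' ≤ dist w w' := by
    rcases c with i | j
    · exact dist_le_pi_dist w w' (Sum.inr i)
    · simp [u, u', upperNode]
  have h1 : ‖w (Sum.inl c)‖ ≤ 1 := by
    rw [Real.norm_of_nonneg (hw.1.1 c)]
    exact (Finset.single_le_sum (fun c _ => hw.1.1 c) (Finset.mem_univ c)).trans hw.1.2
  have h2 : ‖w (Sum.inl c) - w' (Sum.inl c)‖ ≤ dist w w' := by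
    rw [← dist_eq_norm]
    exact dist_le_pi_dist w w' (Sum.inl c)
  have h3 : ‖y u - y u'‖ ≤ K * dist w w' := by
    rw [← dist_eq_norm]
    exact (hy.dist_le_mul _ hu _ hu').trans (by gcongr)
  have h4 : ‖y u' - y 0‖ ≤ K := by
    rw [← dist_eq_norm]
    refine (hy.dist_le_mul _ hu' _ (by simp)).trans ?_
    have : dist u' 0 ≤ 1 := by
      rw [Real.dist_0_eq_abs, abs_of_nonneg hu'.1]
      exact hu'.2
    exact mul_le_of_le_one_right K.2 this
  have h5 : w (Sum.inl c) • (y u - y 0) - w' (Sum.inl c) • (y u' - y 0) =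
      w (Sum.inl c) • (y u - y u') + (w (Sum.inl c) - w' (Sum.inl c)) • (y u' - y 0) := by
    module
  rw [dist_eq_norm, h5]
  refine (norm_add_le _ _).trans ?_
  rw [norm_smul, norm_smul]
  have h6 := mul_le_mul h1 h3 (norm_nonneg _) zero_le_one
  have h7 := mul_le_mul h2 h4 (norm_nonneg _) dist_nonneg
  linarith

/-- The parameters at which the path is differentiable at all nodes. -/
def regularNodeDomain (y : ℝ → (Fin k ⊕ Fin m) ⊕ Fin k → ℝ) :
    Set ((Fin k ⊕ Fin m) ⊕ Fin k → ℝ) :=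
  nodeDomain k m ∩ {w | ∀ i, DifferentiableAt ℝ y (w (Sum.inr i))}

theorem measurableSet_nodeDomain : MeasurableSet (nodeDomain k m) := by
  have h1 : MeasurableSet {w : (Fin k ⊕ Fin m) ⊕ Fin k → ℝ | ∀ c, 0 < w (Sum.inl c)} := by
    rw [Set.ofPred_forall]
    exact MeasurableSet.iInter fun c => measurableSet_lt measurable_const (measurable_pi_apply _)
  have h2 : MeasurableSet {w : (Fin k ⊕ Fin m) ⊕ Fin k → ℝ | ∑ c, w (Sum.inl c) < 1} :=
    measurableSet_lt (by fun_prop) measurable_const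
  have h3 : MeasurableSet {w : (Fin k ⊕ Fin m) ⊕ Fin k → ℝ |
      StrictMono fun i => w (Sum.inr i)} := by
    simp only [StrictMono, Set.ofPred_forall]
    exact MeasurableSet.iInter fun i => MeasurableSet.iInter fun j => MeasurableSet.iInter fun _ =>
      measurableSet_lt (measurable_pi_apply _) (measurable_pi_apply _)
  have h4 : MeasurableSet {w : (Fin k ⊕ Fin m) ⊕ Fin k → ℝ |
      ∀ i, w (Sum.inr i) ∈ Set.Ioo (0 : ℝ) 1} := by
    rw [Set.ofPred_forall]
    exact MeasurableSet.iInter fun i => measurable_pi_apply _ measurableSet_Ioo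
  exact (h1.inter h2).inter (h3.inter h4)

theorem measurableSet_regularNodeDomain : MeasurableSet (regularNodeDomain y) := by
  refine measurableSet_nodeDomain.inter ?_
  rw [Set.ofPred_forall]
  have h : MeasurableSet {t | DifferentiableAt ℝ y t} := measurableSet_of_differentiableAt ℝ y
  exact MeasurableSet.iInter fun i => 
    (measurable_pi_apply (X := fun _ : (Fin k ⊕ Fin m) ⊕ Fin k => ℝ) (Sum.inr i)) h

theorem LipschitzOnWith.ae_differentiableAt_of_mem_Icc {E : Type*} [NormedAddCommGroup E]
    [NormedSpace ℝ E] [FiniteDimensional ℝ E] {f : ℝ → E} {K : NNReal} {a b : ℝ}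
    (hf : LipschitzOnWith K f (Set.Icc a b)) :
    ∀ᵐ t, t ∈ Set.Icc a b → DifferentiableAt ℝ f t ∧ t ∈ Set.Ioo a b := by
  have h0 : ∀ᵐ t : ℝ, t ≠ a := by simp [ae_iff, measure_singleton]
  have h1 : ∀ᵐ t : ℝ, t ≠ b := by simp [ae_iff, measure_singleton]
  filter_upwards [hf.ae_differentiableWithinAt_of_mem_real, h0, h1] with t ht h0 h1 hmem
  have hIoo : t ∈ Set.Ioo a b := ⟨hmem.1.lt_of_ne' h0, hmem.2.lt_of_ne h1⟩
  exact ⟨(ht hmem).differentiableAt (Icc_mem_nhds hIoo.1 hIoo.2), hIoo⟩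

/-- The exceptional parameters have a zero weight, total weight `1`, or a node in the null set
formed by the end points and the points of nondifferentiability. -/
theorem volume_closedNodeDomain_diff {K : NNReal} (hy : LipschitzOnWith K y (Set.Icc 0 1)) :
    volume (closedNodeDomain k m \ regularNodeDomain y) = 0 := by
  have h1 : ∀ᵐ w : (Fin k ⊕ Fin m) ⊕ Fin k → ℝ, ∀ c, w (Sum.inl c) ≠ 0 := by
    refine ae_all_iff.2 fun c => ?_
    have h0 : ∀ᵐ t : ℝ, t ≠ 0 := by simp [ae_iff, measure_singleton]
    exact (Measure.quasiMeasurePreserving_eval (α := fun _ => ℝ) (fun _ => volume) (Sum.inl c)).ae h0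
  have h2 : ∀ᵐ w : (Fin k ⊕ Fin m) ⊕ Fin k → ℝ, ∑ c, w (Sum.inl c) ≠ 1 := by
    simpa [ae_iff] using volume_setOf_sum_eq_one (Sum.inl : Fin k ⊕ Fin m → _ ⊕ Fin k)
  have h3 : ∀ᵐ w : (Fin k ⊕ Fin m) ⊕ Fin k → ℝ, ∀ i, w (Sum.inr i) ∈ Set.Icc (0 : ℝ) 1 →
      DifferentiableAt ℝ y (w (Sum.inr i)) ∧ w (Sum.inr i) ∈ Set.Ioo (0 : ℝ) 1 :=
    ae_all_iff.2 fun i => (Measure.quasiMeasurePreserving_eval (α := fun _ => ℝ) (fun _ => volume) (Sum.inr i)).ae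
      hy.ae_differentiableAt_of_mem_Icc
  refine measure_mono_null ?_ ((h1.and (h2.and h3)) : volume _ = 0)
  rintro w ⟨hw, hwR⟩ ⟨h1, h2, h3⟩
  exact hwR ⟨⟨⟨fun c => (hw.1.1 c).lt_of_ne' (h1 c), hw.1.2.lt_of_ne h2⟩, hw.2.1,
    fun i => (h3 i (hw.2.2 i)).2⟩, fun i => (h3 i (hw.2.2 i)).1⟩

/-- The Jacobian matrix of `nodePoint y`. -/
noncomputable def nodeJacobian (y : ℝ → (Fin k ⊕ Fin m) ⊕ Fin k → ℝ)
    (w : (Fin k ⊕ Fin m) ⊕ Fin k → ℝ) :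
    Matrix ((Fin k ⊕ Fin m) ⊕ Fin k) ((Fin k ⊕ Fin m) ⊕ Fin k) ℝ :=
  Matrix.of fun a b => (Sum.elim (fun _ => 1) (fun i => w (Sum.inl (Sum.inl i))) b : ℝ) *
    nodeMatrix y (deriv y) (fun i => w (Sum.inr i)) a b

theorem det_nodeJacobian (w : (Fin k ⊕ Fin m) ⊕ Fin k → ℝ) :
    (nodeJacobian y w).det = (∏ i, w (Sum.inl (Sum.inl i))) *
      (nodeMatrix y (deriv y) fun i => w (Sum.inr i)).det := by
  rw [nodeJacobian, Matrix.det_mul_row]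
  simp

theorem hasFDerivAt_nodePoint {w : (Fin k ⊕ Fin m) ⊕ Fin k → ℝ}
    (hw : ∀ i, DifferentiableAt ℝ y (w (Sum.inr i))) :
    HasFDerivAt (nodePoint y) (Matrix.toLin' (nodeJacobian y w)).toContinuousLinearMap w := by
  have hterm : ∀ i : Fin k, HasFDerivAt (fun w : (Fin k ⊕ Fin m) ⊕ Fin k → ℝ =>
      w (Sum.inl (Sum.inl i)) • (y (w (Sum.inr i)) - y 0)) _ w := fun i =>
    (hasFDerivAt_apply (Sum.inl (Sum.inl i)) w).fun_smul
      (((hw i).hasDerivAt.hasFDerivAt.comp w (hasFDerivAt_apply (Sum.inr i) w)).sub_const (y 0))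
  have hlast : ∀ j : Fin m, HasFDerivAt (fun w : (Fin k ⊕ Fin m) ⊕ Fin k → ℝ =>
      w (Sum.inl (Sum.inr j)) • (y 1 - y 0))
      ((ContinuousLinearMap.proj (R := ℝ) (φ := fun _ => ℝ) (Sum.inl (Sum.inr j))).smulRight
        (y 1 - y 0)) w := fun j =>
    (hasFDerivAt_apply (Sum.inl (Sum.inr j)) w).smul_const (y 1 - y 0)
  have hsum := ((HasFDerivAt.fun_sum fun i (_ : i ∈ Finset.univ) => hterm i).fun_add
    (HasFDerivAt.fun_sum fun j (_ : j ∈ Finset.univ) => hlast j)).const_add (y 0)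
  have hfun : nodePoint y = fun w : (Fin k ⊕ Fin m) ⊕ Fin k → ℝ => y 0 +
      (∑ i, w (Sum.inl (Sum.inl i)) • (y (w (Sum.inr i)) - y 0) +
        ∑ j, w (Sum.inl (Sum.inr j)) • (y 1 - y 0)) := by
    ext w
    simp [nodePoint, upperNode]
  rw [hfun]
  refine hsum.congr_fderiv ?_
  ext v a
  simp [nodeJacobian, nodeMatrix, Matrix.mulVec, dotProduct, upperNode, Finset.sum_add_distrib]
  rw [add_assoc, add_comm]
  refine congrArg₂ (· + ·) (congrArg₂ (· + ·) ?_ ?_) ?_ <;>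
    exact Finset.sum_congr rfl fun _ _ => by ring

/-- Up to null sets the hull is the injective image of `regularNodeDomain`, where the Jacobian
exists and is nonnegative, so the absolute value in the change of variables can be dropped. -/
theorem volume_real_convexHull_eq_integral {K : NNReal} (hy : LipschitzOnWith K y (Set.Icc 0 1))
    (hinj : Set.InjOn (nodePoint y) (nodeDomain k m))
    (hsurj : interior (convexHull ℝ (y '' Set.Icc 0 1)) ⊆ nodePoint y '' closedNodeDomain k m)
    (hnonneg : ∀ w ∈ regularNodeDomain y,
      0 ≤ (nodeMatrix y (deriv y) fun i => w (Sum.inr i)).det) :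
    volume.real (convexHull ℝ (y '' Set.Icc 0 1)) =
      ∫ w in nodeDomain k m, (∏ i, w (Sum.inl (Sum.inl i))) *
        (nodeMatrix y (deriv y) fun i => w (Sum.inr i)).det := by
  set C := convexHull ℝ (y '' Set.Icc 0 1) with hC
  have hCclosed : IsClosed C := (isCompact_Icc.image_of_continuousOn
    hy.continuousOn).convexHull_of_finiteDimensional.isClosed
  obtain ⟨K', hK'⟩ := exists_lipschitzOnWith_nodePoint hy
  have hRclosed : regularNodeDomain y ⊆ closedNodeDomain k m :=
    Set.inter_subset_left.trans nodeDomain_subset_closedNodeDomain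
  have hnull := volume_closedNodeDomain_diff hy
  have hvol : volume C = volume (nodePoint y '' regularNodeDomain y) := by
    refine le_antisymm ?_ (measure_mono ?_)
    -- The last two sets are null: a Lipschitz image of a null set and the frontier of a convex set.
    · have hsub : C ⊆ nodePoint y '' regularNodeDomain y ∪
          (nodePoint y '' (closedNodeDomain k m \ regularNodeDomain y) ∪ frontier C) := by
        intro p hp
        by_cases hpi : p ∈ interior C
        · obtain ⟨w, hw, rfl⟩ := hsurj hpi
          by_cases hwR : w ∈ regularNodeDomain y
          · exact Or.inl ⟨w, hwR, rfl⟩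
          · exact Or.inr (Or.inl ⟨w, ⟨hw, hwR⟩, rfl⟩)
        · exact Or.inr (Or.inr ⟨subset_closure hp, hpi⟩)
      refine (measure_mono hsub).trans ((measure_union_le _ _).trans ?_)
      rw [measure_union_null ((hK'.mono Set.sdiff_subset).volume_image_eq_zero hnull)
        ((convex_convexHull ℝ _).addHaar_frontier volume), add_zero]
    · rintro _ ⟨w, hw, rfl⟩
      exact nodePoint_mem_convexHull (hRclosed hw)
  have hcv := integral_image_eq_integral_abs_det_fderiv_smul volume
    (measurableSet_regularNodeDomain (y := y))
    (fun w hw => (hasFDerivAt_nodePoint hw.2).hasFDerivWithinAt)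
    (hinj.mono Set.inter_subset_left) (fun _ => (1 : ℝ))
  rw [setIntegral_const, smul_eq_mul, mul_one] at hcv
  rw [measureReal_def, hvol, ← measureReal_def, hcv]
  have hae : regularNodeDomain y =ᵐ[volume] nodeDomain k m := by
    refine (Set.inter_subset_left.eventuallyLE).antisymm ?_
    rw [ae_le_set]
    exact measure_mono_null (Set.sdiff_subset_sdiff_left nodeDomain_subset_closedNodeDomain) hnull
  rw [← setIntegral_congr_set hae]
  refine setIntegral_congr_fun measurableSet_regularNodeDomain fun w hw => ?_
  have hdet : ((Matrix.toLin' (nodeJacobian y w)).toContinuousLinearMap).det =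
      (nodeJacobian y w).det := by
    rw [ContinuousLinearMap.det]
    exact LinearMap.det_toLin' _
  simp only [hdet, smul_eq_mul, mul_one]
  rw [det_nodeJacobian, abs_of_nonneg]
  exact mul_nonneg (Finset.prod_nonneg fun i _ => (hw.1.1.1 _).le) (hnonneg w hw)

end

/-! ### Reindexing and the Dirichlet integral of the weights. -/

/-- Reindexing of the coordinates as a measurable equivalence. -/
def reindexMeasurableEquiv {α β : Type*} (e : α ≃ β) : (β → ℝ) ≃ᵐ (α → ℝ) :=
  MeasurableEquiv.piCongrLeft (fun _ => ℝ) e.symm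

theorem reindexMeasurableEquiv_apply {α β : Type*} (e : α ≃ β) (f : β → ℝ) (a : α) :
    reindexMeasurableEquiv e f a = f (e a) := by
  have h := MeasurableEquiv.piCongrLeft_apply_apply (β := fun _ : α => ℝ) e.symm f (e a)
  rw [Equiv.symm_apply_apply] at h
  exact h

theorem measurePreserving_reindex {α β : Type*} [Fintype α] [Fintype β] (e : α ≃ β) :
    MeasurePreserving (reindexMeasurableEquiv e) :=
  volume_measurePreserving_piCongrLeft (fun _ => ℝ) e.symm

section Dirichlet

/-- A Beta integral, the recursion step for the corner simplex. Restricting to exponents `p ≤ 1`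
avoids a factor `p!`. -/
theorem integral_Ioo_pow_mul_pow {r : ℝ} (hr : 0 < r) {p : ℕ} (hp : p ≤ 1) (M : ℕ) :
    ∫ a in Set.Ioo 0 r, a ^ p * ((r - a) ^ M / M.factorial) =
      r ^ (M + p + 1) / (M + p + 1).factorial := by
  rw [← integral_Ioc_eq_integral_Ioo, ← intervalIntegral.integral_of_le hr.le]
  have h := intervalIntegral.integral_comp_sub_left
    (fun b => (r - b) ^ p * (b ^ M / M.factorial)) r (a := 0) (b := r)
  simp only [sub_sub_cancel, sub_self, sub_zero] at h
  rw [h]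
  have hM : (M.factorial : ℝ) ≠ 0 := by positivity
  interval_cases p
  · simp only [pow_zero, one_mul, add_zero]
    rw [intervalIntegral.integral_div, integral_pow, Nat.factorial_succ]
    push_cast
    field_simp
    simp
  · have h1 : ∀ b : ℝ, (r - b) ^ 1 * (b ^ M / M.factorial) =
        (r * b ^ M - b ^ (M + 1)) / M.factorial := fun b => by ring
    simp_rw [h1]
    rw [intervalIntegral.integral_div, intervalIntegral.integral_sub
      (by apply Continuous.intervalIntegrable; fun_prop)
      (by apply Continuous.intervalIntegrable; fun_prop), intervalIntegral.integral_const_mul,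
      integral_pow, integral_pow, Nat.factorial_succ, Nat.factorial_succ]
    push_cast
    field_simp
    simp
    ring

/-- The open corner simplex of size `r`. -/
def cornerSimplex (κ : Type*) [Fintype κ] (r : ℝ) : Set (κ → ℝ) :=
  {v | (∀ c, 0 < v c) ∧ ∑ c, v c < r}

theorem measurableSet_cornerSimplex {κ : Type*} [Fintype κ] (r : ℝ) :
    MeasurableSet (cornerSimplex κ r) := by
  have h1 : MeasurableSet {v : κ → ℝ | ∀ c, 0 < v c} := by
    rw [Set.ofPred_forall]
    exact MeasurableSet.iInter fun c => measurableSet_lt measurable_const (measurable_pi_apply _)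
  have h2 : MeasurableSet {v : κ → ℝ | ∑ c, v c < r} :=
    measurableSet_lt (by fun_prop) measurable_const
  exact h1.inter h2

theorem integrableOn_cornerSimplex {κ : Type*} [Fintype κ] (r : ℝ) {f : (κ → ℝ) → ℝ}
    (hf : Continuous f) : IntegrableOn f (cornerSimplex κ r) := by
  have hcomp : IsCompact (Set.Icc (0 : κ → ℝ) fun _ => r) := isCompact_Icc
  refine (hf.continuousOn.integrableOn_compact hcomp).mono_set fun v hv =>
    ⟨fun c => (hv.1 c).le, fun c => ?_⟩
  exact (Finset.single_le_sum (fun c _ => (hv.1 c).le) (Finset.mem_univ c)).trans hv.2.le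

/-- Slicing at the first coordinate `a` leaves a corner simplex of size `r - a`, so the induction
needs all sizes `r`. -/
theorem integral_cornerSimplex_fin {N : ℕ} (p : Fin N → ℕ) (hp : ∀ i, p i ≤ 1) {r : ℝ}
    (hr : 0 < r) : ∫ v in cornerSimplex (Fin N) r, ∏ i, v i ^ p i =
      r ^ (N + ∑ i, p i) / (N + ∑ i, p i).factorial := by
  induction N generalizing r with
  | zero =>
    have : cornerSimplex (Fin 0) r = Set.univ := by
      ext v
      simp [cornerSimplex, hr]
    simp [this, measureReal_def, volume_pi]
  | succ N ih =>
    let e := MeasurableEquiv.piFinSuccAbove (fun _ : Fin (N + 1) => ℝ) 0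
    have he : MeasurePreserving e := volume_preserving_piFinSuccAbove (fun _ => ℝ) 0
    let S : Set (ℝ × (Fin N → ℝ)) := e.symm ⁻¹' cornerSimplex (Fin (N + 1)) r
    have hS : MeasurableSet S := e.symm.measurable (measurableSet_cornerSimplex r)
    have hsymm : ∀ z, e.symm z = Fin.cons z.1 z.2 := fun z => by
      simp only [e, MeasurableEquiv.piFinSuccAbove, MeasurableEquiv.symm_mk,
        MeasurableEquiv.coe_mk, Equiv.symm_symm, Fin.insertNthEquiv_zero]
      rfl
    have hSmem : ∀ a v, (a, v) ∈ S ↔ a ∈ Set.Ioo 0 r ∧ v ∈ cornerSimplex (Fin N) (r - a) := by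
      intro a v
      simp only [S, Set.mem_preimage, hsymm, cornerSimplex, Set.mem_ofPred_eq, Fin.forall_fin_succ,
        Fin.sum_univ_succ, Fin.cons_zero, Fin.cons_succ, Set.mem_Ioo]
      constructor
      · rintro ⟨⟨h1, h2⟩, h3⟩
        have := Finset.sum_nonneg fun i (_ : i ∈ Finset.univ) => (h2 i).le
        exact ⟨⟨h1, by linarith⟩, h2, by linarith⟩
      · rintro ⟨⟨h1, -⟩, h2, h3⟩
        exact ⟨⟨h1, h2⟩, by linarith⟩
    have hint : IntegrableOn (fun z : ℝ × (Fin N → ℝ) => ∏ i, e.symm z i ^ p i) S := by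
      have := integrableOn_cornerSimplex (κ := Fin (N + 1)) r
        (f := fun v => ∏ i, v i ^ p i) (by fun_prop)
      exact (he.symm.integrableOn_comp_preimage e.symm.measurableEmbedding).2 this
    have h1 : ∫ v in cornerSimplex (Fin (N + 1)) r, ∏ i, v i ^ p i =
        ∫ z in S, ∏ i, e.symm z i ^ p i :=
      (he.symm.setIntegral_preimage_emb e.symm.measurableEmbedding
        (fun v : Fin (N + 1) → ℝ => ∏ i, v i ^ p i) _).symm
    rw [h1, ← integral_indicator hS]
    have hint' := hint.integrable_indicator hS
    rw [Measure.volume_eq_prod] at hint' ⊢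
    rw [integral_prod _ hint']
    have hinner : ∀ a, ∫ v, S.indicator (fun z => ∏ i, e.symm z i ^ p i) (a, v) =
        (Set.Ioo 0 r).indicator (fun a => a ^ p 0 * ((r - a) ^ (N + ∑ i, p (Fin.succ i)) /
          (N + ∑ i, p (Fin.succ i)).factorial)) a := by
      intro a
      by_cases ha : a ∈ Set.Ioo 0 r
      · have hfun : (fun v => S.indicator (fun z => ∏ i, e.symm z i ^ p i) (a, v)) =
            (cornerSimplex (Fin N) (r - a)).indicator
              fun v => a ^ p 0 * ∏ i, v i ^ p (Fin.succ i) := by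
          ext v
          by_cases hv : v ∈ cornerSimplex (Fin N) (r - a)
          · rw [Set.indicator_of_mem ((hSmem a v).2 ⟨ha, hv⟩), Set.indicator_of_mem hv, hsymm,
              Fin.prod_univ_succ]
            simp
          · rw [Set.indicator_of_notMem (fun h => hv ((hSmem a v).1 h).2),
              Set.indicator_of_notMem hv]
        rw [hfun, integral_indicator (measurableSet_cornerSimplex _), integral_const_mul,
          ih (fun i => p i.succ) (fun i => hp _) (sub_pos.2 ha.2), Set.indicator_of_mem ha]
      · rw [Set.indicator_of_notMem ha]
        have hfun : (fun v => S.indicator (fun z => ∏ i, e.symm z i ^ p i) (a, v)) = 0 := by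
          ext v
          exact Set.indicator_of_notMem (fun h => ha ((hSmem a v).1 h).1) _
        rw [hfun]
        simp
    simp_rw [hinner]
    rw [integral_indicator measurableSet_Ioo, integral_Ioo_pow_mul_pow hr (hp 0),
      Fin.sum_univ_succ]
    have : N + ∑ i, p (Fin.succ i) + p 0 + 1 = N + 1 + (p 0 + ∑ i, p (Fin.succ i)) := by ring
    rw [this]

/-- Exponent `1` at `k` weights and `0` at the other `m` gives `(k + m) + k = 2k + m` in the
factorial. -/
theorem integral_cornerSimplex_sum (k m : ℕ) :
    ∫ v in cornerSimplex (Fin k ⊕ Fin m) 1, ∏ i, v (Sum.inl i) =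
      1 / ((2 * k + m).factorial : ℝ) := by
  let q : Fin k ⊕ Fin m → ℕ := Sum.elim (fun _ => 1) fun _ => 0
  let e := finSumFinEquiv (m := k) (n := m)
  have h := integral_cornerSimplex_fin (fun i => q (e.symm i)) (fun i => by
    rcases e.symm i with j | j <;> simp [q]) zero_lt_one
  have hsum : ∑ i, q (e.symm i) = k := by
    rw [Equiv.sum_comp e.symm q]
    simp [q]
  rw [hsum, one_pow] at h
  have hk : k + m + k = 2 * k + m := by ring
  rw [hk] at h
  rw [← h, ← (measurePreserving_reindex e).setIntegral_preimage_emb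
    (reindexMeasurableEquiv e).measurableEmbedding]
  congr 1
  · congr 1
    ext v
    simp only [cornerSimplex, Set.mem_preimage, Set.mem_ofPred_eq, reindexMeasurableEquiv_apply]
    rw [e.forall_congr_left, Equiv.sum_comp e v]
    simp
  · ext v
    simp only [reindexMeasurableEquiv_apply]
    rw [← Equiv.prod_comp e]
    simp [q]

end Dirichlet

/-! ### Fubini on the interleaved simplex. -/

section Fubini

/-- Each integrated column depends on its own variable only, so every Leibniz term is a product of
one-variable integrals. -/
theorem integral_pi_det {κ μ' : Type*} [Fintype κ] [Fintype μ'] [DecidableEq κ] [DecidableEq μ']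
    (ν : κ → Measure ℝ) [∀ c, SigmaFinite (ν c)] (f : κ → ℝ → κ ⊕ μ' → ℝ)
    (hf : ∀ c a, Integrable (fun t => f c t a) (ν c)) (h : μ' → κ ⊕ μ' → ℝ) :
    ∫ v, (Matrix.of fun a b => Sum.elim (fun c => f c (v c) a) (fun i => h i a) b :
        Matrix (κ ⊕ μ') (κ ⊕ μ') ℝ).det ∂(Measure.pi ν) =
      (Matrix.of fun a b => Sum.elim (fun c => ∫ t, f c t a ∂(ν c)) (fun i => h i a) b :
        Matrix (κ ⊕ μ') (κ ⊕ μ') ℝ).det := by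
  simp only [Matrix.det_apply', Fintype.prod_sum_type, Matrix.of_apply, Sum.elim_inl,
    Sum.elim_inr]
  rw [integral_finsetSum]
  · refine Finset.sum_congr rfl fun σ _ => ?_
    rw [integral_const_mul, integral_mul_const]
    congr 2
    exact integral_fintype_prod_eq_prod (μ := ν) (fun c t => f c t (σ (Sum.inl c)))
  · intro σ _
    exact ((Integrable.fintype_prod (μ := ν) (f := fun c t => f c t (σ (Sum.inl c)))
      fun c => hf c _).mul_const _).const_mul _

variable {k m : ℕ}

/-- The open order simplex in interleaved coordinates. -/
def interleavedSimplex (k m : ℕ) : Set ((Fin k ⊕ Fin m) ⊕ Fin k → ℝ) :=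
  {w | (∀ a b, interleave k m a < interleave k m b → w a < w b) ∧ ∀ a, w a ∈ Set.Ioo (0 : ℝ) 1}

/-- The open order simplex. -/
def openOrderSimplex (k : ℕ) : Set (Fin k → ℝ) :=
  {s | StrictMono s ∧ ∀ i, s i ∈ Set.Ioo (0 : ℝ) 1}

/-- Once the nodes are fixed, the other variables range independently over the gaps, so the fibres
are boxes. This needs `m ≤ 1`: two variables after the last node would have to be ordered between
themselves. -/
theorem mem_interleavedSimplex_iff (hm : m ≤ 1) (w : (Fin k ⊕ Fin m) ⊕ Fin k → ℝ) :
    w ∈ interleavedSimplex k m ↔ (fun i => w (Sum.inr i)) ∈ openOrderSimplex k ∧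
      ∀ c, w (Sum.inl c) ∈ Set.Ioo (lowerNode m (fun i => w (Sum.inr i)) c)
        (upperNode m (fun i => w (Sum.inr i)) c) := by
  constructor
  · rintro ⟨h1, h2⟩
    refine ⟨⟨fun i j hij => h1 _ _ ?_, fun i => h2 _⟩, fun c => ⟨?_, ?_⟩⟩
    · rw [Fin.lt_def] at hij ⊢
      simp
      omega
    · rcases lowerNode_eq (fun i => w (Sum.inr i)) c with ⟨h, -⟩ | ⟨i, h, hlt, -⟩
      · rw [h]
        exact (h2 _).1
      · rw [h]
        exact h1 _ _ hlt
    · rcases c with i | j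
      · refine h1 _ _ ?_
        rw [Fin.lt_def]
        simp
      · exact (h2 _).2
  · rintro ⟨⟨hs, hs01⟩, hc⟩
    have hlow : ∀ c i, interleave k m (Sum.inr i) < interleave k m (Sum.inl c) →
        w (Sum.inr i) < w (Sum.inl c) := by
      intro c i hic
      refine lt_of_le_of_lt ?_ (hc c).1
      rcases lowerNode_eq (fun i => w (Sum.inr i)) c with ⟨-, h⟩ | ⟨j, h, -, hj⟩
      · exact (lt_asymm hic (h i)).elim
      · rw [h]
        exact hs.monotone (hj i hic)
    have hup : ∀ i j : Fin k, i ≤ j → w (Sum.inl (Sum.inl i)) < w (Sum.inr j) := fun i j hij =>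
      (hc (Sum.inl i)).2.trans_le (hs.monotone hij)
    constructor
    · intro a b hab
      have hab' := Fin.lt_def.1 hab
      rcases a with (i | i) | i <;> rcases b with (j | j) | j <;> simp at hab'
      · refine (hup i i le_rfl).trans (hlow _ _ ?_)
        rw [Fin.lt_def]
        simp
        omega
      · refine (hup i i le_rfl).trans (hlow _ _ ?_)
        rw [Fin.lt_def]
        simp
        omega
      · exact hup i j (by omega)
      · omega
      · omega
      · omega
      · exact hlow _ _ hab
      · exact hlow _ _ hab
      · exact hs (by omega)
    · rintro (c | i)
      · constructor
        · refine lt_of_le_of_lt ?_ (hc c).1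
          rcases lowerNode_eq (fun i => w (Sum.inr i)) c with ⟨h, -⟩ | ⟨j, h, -, -⟩
          · exact h.ge
          · rw [h]
            exact (hs01 j).1.le
        · refine (hc c).2.trans_le ?_
          rcases c with i | j
          · exact (hs01 i).2.le
          · exact le_rfl
      · exact hs01 i

theorem measurableSet_interleavedSimplex : MeasurableSet (interleavedSimplex k m) := by
  have h1 : MeasurableSet {w : (Fin k ⊕ Fin m) ⊕ Fin k → ℝ |
      ∀ a b, interleave k m a < interleave k m b → w a < w b} := by
    simp only [Set.ofPred_forall]
    exact MeasurableSet.iInter fun i => MeasurableSet.iInter fun j => MeasurableSet.iInter fun _ =>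
      measurableSet_lt (measurable_pi_apply _) (measurable_pi_apply _)
  have h2 : MeasurableSet {w : (Fin k ⊕ Fin m) ⊕ Fin k → ℝ | ∀ a, w a ∈ Set.Ioo (0 : ℝ) 1} := by
    rw [Set.ofPred_forall]
    exact MeasurableSet.iInter fun i => measurable_pi_apply _ measurableSet_Ioo
  exact h1.inter h2

theorem measurableSet_openOrderSimplex : MeasurableSet (openOrderSimplex k) := by
  have h1 : MeasurableSet {s : Fin k → ℝ | StrictMono s} := by
    simp only [StrictMono, Set.ofPred_forall]
    exact MeasurableSet.iInter fun i => MeasurableSet.iInter fun j => MeasurableSet.iInter fun _ =>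
      measurableSet_lt (measurable_pi_apply _) (measurable_pi_apply _)
  have h2 : MeasurableSet {s : Fin k → ℝ | ∀ a, s a ∈ Set.Ioo (0 : ℝ) 1} := by
    rw [Set.ofPred_forall]
    exact MeasurableSet.iInter fun i => measurable_pi_apply _ measurableSet_Ioo
  exact h1.inter h2

theorem integrableOn_interleavedSimplex_det {g : ℝ → (Fin k ⊕ Fin m) ⊕ Fin k → ℝ}
    (hg : Measurable g) {K : ℝ} (hK : ∀ t ∈ Set.Ioo (0 : ℝ) 1, ∀ a, |g t a| ≤ K) :
    IntegrableOn (fun w => (Matrix.of fun a b => g (w b) a).det) (interleavedSimplex k m) := by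
  have hfin : volume (interleavedSimplex k m) ≠ ⊤ := by
    have hsub : interleavedSimplex k m ⊆ Set.univ.pi fun _ => Set.Ioo (0 : ℝ) 1 :=
      fun w hw a _ => hw.2 a
    refine ne_top_of_le_ne_top ?_ (measure_mono hsub)
    rw [volume_pi_pi]
    simp
  have hmeas : Measurable fun w : (Fin k ⊕ Fin m) ⊕ Fin k → ℝ =>
      (Matrix.of fun a b => g (w b) a).det := by
    simp only [Matrix.det_apply']
    refine Finset.measurable_sum _ fun σ _ => Measurable.const_mul ?_ _
    refine Finset.measurable_prod _ fun b _ => ?_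
    exact ((measurable_pi_apply (σ b)).comp hg).comp (measurable_pi_apply b)
  refine Measure.integrableOn_of_bounded hfin hmeas.aestronglyMeasurable
    (M := (Fintype.card ((Fin k ⊕ Fin m) ⊕ Fin k)).factorial •
      K ^ Fintype.card ((Fin k ⊕ Fin m) ⊕ Fin k)) ?_
  refine (ae_restrict_iff' measurableSet_interleavedSimplex).2 (Filter.Eventually.of_forall ?_)
  intro w hw
  exact Matrix.det_le (abv := AbsoluteValue.abs) fun a b => hK _ (hw.2 b) a

/-- Integrating out the variables at the positions of the weights. -/
theorem integral_interleavedSimplex_det (hm : m ≤ 1) {g : ℝ → (Fin k ⊕ Fin m) ⊕ Fin k → ℝ}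
    (hg : Measurable g) {K : ℝ} (hK : ∀ t ∈ Set.Ioo (0 : ℝ) 1, ∀ a, |g t a| ≤ K) :
    ∫ w in interleavedSimplex k m, (Matrix.of fun a b => g (w b) a).det =
      ∫ s in openOrderSimplex k, (Matrix.of fun a b => Sum.elim
        (fun c => ∫ t in Set.Ioo (lowerNode m s c) (upperNode m s c), g t a)
        (fun i => g (s i) a) b : Matrix _ _ ℝ).det := by
  let e := MeasurableEquiv.sumPiEquivProdPi fun _ : (Fin k ⊕ Fin m) ⊕ Fin k => ℝ
  have he : MeasurePreserving e :=
    volume_measurePreserving_sumPiEquivProdPi fun _ : (Fin k ⊕ Fin m) ⊕ Fin k => ℝ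
  have hsl : ∀ z c, e.symm z (Sum.inl c) = z.1 c := fun z c => rfl
  have hsr : ∀ z i, e.symm z (Sum.inr i) = z.2 i := fun z i => rfl
  let F : ((Fin k ⊕ Fin m) ⊕ Fin k → ℝ) → ℝ := fun w => (Matrix.of fun a b => g (w b) a).det
  let S := e.symm ⁻¹' interleavedSimplex k m
  have hS : MeasurableSet S := e.symm.measurable measurableSet_interleavedSimplex
  have hint : IntegrableOn (fun z => F (e.symm z)) S :=
    (he.symm.integrableOn_comp_preimage e.symm.measurableEmbedding).2
      (integrableOn_interleavedSimplex_det hg hK)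
  have h1 : ∫ w in interleavedSimplex k m, F w = ∫ z in S, F (e.symm z) :=
    (he.symm.setIntegral_preimage_emb e.symm.measurableEmbedding F _).symm
  change ∫ w in interleavedSimplex k m, F w = _
  rw [h1, ← integral_indicator hS, ← integral_indicator measurableSet_openOrderSimplex]
  have hint' := hint.integrable_indicator hS
  rw [Measure.volume_eq_prod] at hint' ⊢
  rw [integral_prod_symm _ hint']
  congr 1
  ext s
  have hSmem : ∀ v, (v, s) ∈ S ↔ s ∈ openOrderSimplex k ∧
      v ∈ Set.univ.pi fun c => Set.Ioo (lowerNode m s c) (upperNode m s c) := by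
    intro v
    change e.symm (v, s) ∈ interleavedSimplex k m ↔ _
    rw [mem_interleavedSimplex_iff hm]
    simp [hsl, hsr, Set.mem_pi]
  by_cases hs : s ∈ openOrderSimplex k
  · rw [Set.indicator_of_mem hs]
    have hbox : MeasurableSet
        (Set.univ.pi fun c => Set.Ioo (lowerNode m s c) (upperNode m s c)) :=
      MeasurableSet.univ_pi fun c => measurableSet_Ioo
    have hfun : (fun v => S.indicator (fun z => F (e.symm z)) (v, s)) =
        (Set.univ.pi fun c => Set.Ioo (lowerNode m s c) (upperNode m s c)).indicator fun v =>
          (Matrix.of fun a b => Sum.elim (fun c => g (v c) a) (fun i => g (s i) a) b :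
            Matrix _ _ ℝ).det := by
      ext v
      by_cases hv : v ∈ Set.univ.pi fun c => Set.Ioo (lowerNode m s c) (upperNode m s c)
      · rw [Set.indicator_of_mem ((hSmem v).2 ⟨hs, hv⟩), Set.indicator_of_mem hv]
        refine congrArg Matrix.det ?_
        ext a (c | i)
        · rfl
        · rfl
      · rw [Set.indicator_of_notMem (fun h => hv ((hSmem v).1 h).2),
          Set.indicator_of_notMem hv]
    rw [hfun, integral_indicator hbox, volume_pi, Measure.restrict_pi_pi]
    refine integral_pi_det _ (fun _ => g) (fun c a => ?_) _
    refine Measure.integrableOn_of_bounded (by simp)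
      ((measurable_pi_apply a).comp hg).aestronglyMeasurable (M := K) ?_
    refine (ae_restrict_iff' measurableSet_Ioo).2 (Filter.Eventually.of_forall fun t ht => ?_)
    refine hK t ⟨?_, ?_⟩ a
    · refine lt_of_le_of_lt ?_ ht.1
      rcases lowerNode_eq s c with ⟨h, -⟩ | ⟨j, h, -, -⟩
      · exact h.ge
      · rw [h]
        exact (hs.2 j).1.le
    · exact ht.2.trans_le (upperNode_mem_Icc (fun i => Set.Ioo_subset_Icc_self (hs.2 i)) c).2
  · rw [Set.indicator_of_notMem hs]
    have hfun : (fun v => S.indicator (fun z => F (e.symm z)) (v, s)) = 0 := by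
      ext v
      exact Set.indicator_of_notMem (fun h => hs ((hSmem v).1 h).1) _
    rw [hfun]
    simp

end Fubini

/-! ### Return to the original coordinates and conclusion. -/

section

variable {k m : ℕ}

/-- The reindexing of coordinates underlying `interleavedPath`. -/
noncomputable def interleaveCLE (k m : ℕ) :
    EuclideanSpace ℝ (Fin (2 * k + m)) ≃L[ℝ] ((Fin k ⊕ Fin m) ⊕ Fin k → ℝ) :=
  ((WithLp.linearEquiv 2 ℝ (Fin (2 * k + m) → ℝ)).trans
    (LinearEquiv.funCongrLeft ℝ ℝ (interleave k m))).toContinuousLinearEquiv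

theorem interleavedPath_eq (x : ℝ → EuclideanSpace ℝ (Fin (2 * k + m))) :
    interleavedPath x = fun t => interleaveCLE k m (x t) := rfl

theorem measurePreserving_interleaveCLE : MeasurePreserving (interleaveCLE k m) := by
  have h := (measurePreserving_reindex (interleave k m)).comp
    (PiLp.volume_preserving_ofLp (Fin (2 * k + m)))
  convert h using 1
  ext v a
  exact (reindexMeasurableEquiv_apply _ _ _).symm

/-- Differentiability is not required: composing with a continuous linear equivalence neither
creates nor destroys it. -/
theorem deriv_interleavedPath (x : ℝ → EuclideanSpace ℝ (Fin (2 * k + m))) (t : ℝ)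
    (a : (Fin k ⊕ Fin m) ⊕ Fin k) :
    deriv (interleavedPath x) t a = deriv x t (interleave k m a) := by
  rw [← fderiv_apply_one_eq_deriv, ← fderiv_apply_one_eq_deriv, interleavedPath_eq]
  have := (interleaveCLE k m).comp_fderiv (f := x) (x := t)
  change fderiv ℝ (interleaveCLE k m ∘ x) t 1 a = _
  rw [this]
  rfl

theorem nodePoint_interleavedPath (x : ℝ → EuclideanSpace ℝ (Fin (2 * k + m)))
    (w : (Fin k ⊕ Fin m) ⊕ Fin k → ℝ) :
    nodePoint (interleavedPath x) w = interleaveCLE k m (nodePoint x w) := by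
  simp [nodePoint, interleavedPath_eq, map_sum]

theorem convexHull_interleavedPath (x : ℝ → EuclideanSpace ℝ (Fin (2 * k + m))) :
    convexHull ℝ (interleavedPath x '' Set.Icc 0 1) =
      interleaveCLE k m '' convexHull ℝ (x '' Set.Icc 0 1) := by
  have h := (interleaveCLE k m).toLinearEquiv.toLinearMap.image_convexHull (x '' Set.Icc 0 1)
  rw [interleavedPath_eq]
  refine Eq.trans ?_ h.symm
  rw [← Set.image_comp]
  rfl

/-- Lipschitz functions are absolutely continuous, so the fundamental theorem applies to each
coordinate; almost everywhere the derivative of the coordinate is the coordinate of the derivative.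
-/
theorem setIntegral_Ioo_deriv_apply {ι : Type*} [Fintype ι] {y : ℝ → ι → ℝ} {K : NNReal}
    (hy : LipschitzOnWith K y (Set.Icc 0 1)) {p q : ℝ} (hp : 0 ≤ p) (hpq : p ≤ q) (hq : q ≤ 1)
    (a : ι) : ∫ t in Set.Ioo p q, deriv y t a = y q a - y p a := by
  have hya : LipschitzOnWith K (fun t => y t a) (Set.Icc 0 1) := by
    have h := (LipschitzWith.eval a).comp_lipschitzOnWith hy
    rwa [one_mul] at h
  have hsub : Set.uIcc p q ⊆ Set.Icc 0 1 := by
    rw [Set.uIcc_of_le hpq]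
    exact Set.Icc_subset_Icc hp hq
  have hac := (hya.mono hsub).absolutelyContinuousOnInterval
  rw [← hac.integral_deriv_eq_sub, intervalIntegral.integral_of_le hpq,
    integral_Ioc_eq_integral_Ioo]
  refine setIntegral_congr_ae measurableSet_Ioo ?_
  filter_upwards [hy.ae_differentiableAt_of_mem_Icc] with t ht hmem
  have hd := (ht ⟨hp.trans hmem.1.le, hmem.2.le.trans hq⟩).1
  exact ((hasDerivAt_pi.1 hd.hasDerivAt) a).deriv.symm

theorem orderSimplex_ae_eq (d : ℕ) : openOrderSimplex d =ᵐ[volume] orderSimplex d := by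
  have hsub : openOrderSimplex d ⊆ orderSimplex d :=
    fun t ht => ⟨ht.1, fun i => Set.Ioo_subset_Icc_self (ht.2 i)⟩
  refine hsub.eventuallyLE.antisymm ?_
  · have h : ∀ᵐ t : Fin d → ℝ, ∀ i, t i ≠ 0 ∧ t i ≠ 1 := by
      refine ae_all_iff.2 fun i => ?_
      have h0 : ∀ᵐ t : ℝ, t ≠ 0 := by simp [ae_iff, measure_singleton]
      have h1 : ∀ᵐ t : ℝ, t ≠ 1 := by simp [ae_iff, measure_singleton]
      exact (Measure.quasiMeasurePreserving_eval (α := fun _ => ℝ) (fun _ => volume) i).ae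
        (h0.and h1)
    filter_upwards [h] with t ht hmem
    exact ⟨hmem.1, fun i => ⟨(hmem.2 i).1.lt_of_ne' (ht i).1, (hmem.2 i).2.lt_of_ne (ht i).2⟩⟩

theorem integral_orderSimplex_det_deriv (x : ℝ → EuclideanSpace ℝ (Fin (2 * k + m))) :
    ∫ t in orderSimplex (2 * k + m),
        (Matrix.of fun i j : Fin (2 * k + m) => deriv x (t j) i).det =
      ∫ w in interleavedSimplex k m,
        (Matrix.of fun a b => deriv (interleavedPath x) (w b) a).det := by
  rw [← setIntegral_congr_set (orderSimplex_ae_eq _),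
    ← (measurePreserving_reindex (interleave k m)).setIntegral_preimage_emb
      (reindexMeasurableEquiv (interleave k m)).measurableEmbedding]
  have hset : reindexMeasurableEquiv (interleave k m) ⁻¹' interleavedSimplex k m =
      openOrderSimplex (2 * k + m) := by
    ext t
    simp only [interleavedSimplex, openOrderSimplex, Set.mem_preimage, Set.mem_ofPred_eq,
      reindexMeasurableEquiv_apply]
    refine and_congr ⟨fun h i j hij => ?_, fun h a b hab => h hab⟩
      ⟨fun h i => ?_, fun h a => h _⟩
    · simpa using h ((interleave k m).symm i) ((interleave k m).symm j) (by simpa using hij)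
    · simpa using h ((interleave k m).symm i)
  rw [hset]
  congr 1
  ext t
  rw [← Matrix.det_submatrix_equiv_self (interleave k m)]
  congr 1
  ext a b
  simp [reindexMeasurableEquiv_apply, deriv_interleavedPath]

/-- The domain is a product of a corner simplex of weights and an order simplex of nodes; the first
factor produces `1 / d!`. -/
theorem integral_nodeDomain (f : (Fin k → ℝ) → ℝ) :
    ∫ w in nodeDomain k m, (∏ i, w (Sum.inl (Sum.inl i))) * f (fun i => w (Sum.inr i)) =
      1 / ((2 * k + m).factorial : ℝ) * ∫ s in openOrderSimplex k, f s := by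
  rw [← integral_cornerSimplex_sum, ← setIntegral_prod_mul]
  exact (volume_measurePreserving_sumPiEquivProdPi
    fun _ : (Fin k ⊕ Fin m) ⊕ Fin k => ℝ).setIntegral_preimage_emb
    (MeasurableEquiv.sumPiEquivProdPi _).measurableEmbedding
    (fun z => (∏ i, z.1 (Sum.inl i)) * f z.2)
    (cornerSimplex (Fin k ⊕ Fin m) 1 ×ˢ openOrderSimplex k)

theorem IsDOrderPath.volume_real_convexHull {x : ℝ → EuclideanSpace ℝ (Fin (2 * k + m))}
    (hx : IsDOrderPath x) (hm : m ≤ 1) :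
    volume.real (convexHull ℝ (x '' Set.Icc 0 1)) = 1 / ((2 * k + m).factorial : ℝ) *
      ∫ t in orderSimplex (2 * k + m),
        (Matrix.of fun i j : Fin (2 * k + m) => deriv x (t j) i).det := by
  obtain ⟨K₀, hK₀⟩ := hx.lipschitz
  obtain ⟨K, hy⟩ : ∃ K, LipschitzOnWith K (interleavedPath x) (Set.Icc 0 1) :=
    ⟨_, (interleaveCLE k m).lipschitz.comp_lipschitzOnWith hK₀⟩
  have hhull := convexHull_interleavedPath x
  have hmeas : MeasurableSet (convexHull ℝ (interleavedPath x '' Set.Icc 0 1)) :=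
    (isCompact_Icc.image_of_continuousOn
      hy.continuousOn).convexHull_of_finiteDimensional.isClosed.measurableSet
  have hvol : volume.real (convexHull ℝ (x '' Set.Icc 0 1)) =
      volume.real (convexHull ℝ (interleavedPath x '' Set.Icc 0 1)) := by
    rw [measureReal_def, measureReal_def,
      ← measurePreserving_interleaveCLE.measure_preimage hmeas.nullMeasurableSet, hhull,
      Set.preimage_image_eq _ (interleaveCLE k m).injective]
  rw [hvol, volume_real_convexHull_eq_integral hy,
    integral_nodeDomain
      fun s => (nodeMatrix (interleavedPath x) (deriv (interleavedPath x)) s).det,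
    integral_orderSimplex_det_deriv, integral_interleavedSimplex_det hm
      (measurable_deriv _) (K := K)]
  · congr 1
    -- For fixed nodes, pass to consecutive increments and recognize them as the integrals of the
    -- derivative over the gaps.
    refine setIntegral_congr_fun measurableSet_openOrderSimplex fun s hs => ?_
    rw [← det_nodeMatrix_eq]
    refine congrArg Matrix.det ?_
    ext a (c | i)
    · have hlow : 0 ≤ lowerNode m s c ∧ lowerNode m s c ≤ upperNode m s c := by
        rcases lowerNode_eq s c with ⟨h, -⟩ | ⟨j, h, hlt, -⟩
        · rw [h]
          exact ⟨le_rfl, (upperNode_mem_Icc (fun i => Set.Ioo_subset_Icc_self (hs.2 i)) c).1⟩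
        · rw [h]
          refine ⟨(hs.2 j).1.le, ?_⟩
          rcases c with i | l
          · refine hs.1.monotone ?_
            rw [Fin.lt_def] at hlt
            rw [Fin.le_def]
            simp at hlt
            omega
          · exact (hs.2 j).2.le
      exact (setIntegral_Ioo_deriv_apply hy hlow.1 hlow.2
        (upperNode_mem_Icc (fun i => Set.Ioo_subset_Icc_self (hs.2 i)) c).2 a).symm
    · rfl
  · intro t ht a
    exact (norm_le_pi_norm (deriv (interleavedPath x) t) a).trans
      (norm_deriv_le_of_lipschitzOn (Icc_mem_nhds ht.1 ht.2) hy)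
  · intro w hw w' hw' h
    rw [nodePoint_interleavedPath, nodePoint_interleavedPath] at h
    exact hx.injOn_nodePoint hm hw hw' ((interleaveCLE k m).injective h)
  · rw [hhull]
    have hint : interior (interleaveCLE k m '' convexHull ℝ (x '' Set.Icc 0 1)) =
        interleaveCLE k m '' interior (convexHull ℝ (x '' Set.Icc 0 1)) :=
      ((interleaveCLE k m).toHomeomorph.image_interior _).symm
    rw [hint]
    rintro _ ⟨p, hp, rfl⟩
    obtain ⟨w, hw, rfl⟩ := hx.interior_convexHull_subset hm hp
    exact ⟨w, hw, nodePoint_interleavedPath x w⟩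
  · intro w hw
    exact hx.det_nodeMatrix_nonneg hm hw.1.2.1 hw.1.2.2 fun i => (hw.2 i).hasDerivAt

end

theorem theorem3p4 {d : ℕ} (x : ℝ → EuclideanSpace ℝ (Fin d)) (hx : IsDOrderPath x) :
    volume.real (convexHull ℝ (x '' Set.Icc 0 1)) = topAltSignature x := by
  obtain ⟨k, m, hm, rfl⟩ : ∃ k m, m ≤ 1 ∧ d = 2 * k + m :=
    ⟨d / 2, d % 2, by omega, by omega⟩
  exact hx.volume_real_convexHull hm
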